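/- Let $(V,Y,\mathbf 1,\omega)$ be a vertex operator algebra over $\mathbb C$ with central charge $c$, $L(n)=\omega(n+1)$, and let $U$ be a $V$-module of the form $U=\bigoplus_{n\ge 0}U_{r+n}$ with finite-dimensional $L(0)$-eigenspaces $U_{r+n}$ of eigenvalue $r+n$ (for instance an irreducible module of lowest weight $r$). Suppose that $r=t+2m$ with $t\in\mathbb R$, $m\in\mathbb Z$. For homogeneous $v\in V$ put $$v[n]=\operatorname{Res}_z\,Y(v,z)(\log(1+z))^n(1+z)^{\mathrm{wt}(v)-1}\qquad(n\in\mathbb Z),$$ extended linearly in $v$, let $\tilde\omega=\omega-c/24$, $L[n]=\tilde\omega[n+1]$, and $U_{[k]}=\{u\in U: L[0]u=ku\}$. Let $M(\Gamma(1))$ be the ring of holomorphic modular forms on $SL(2,\mathbb Z)$, and let $E_{2l}(\tau)=(2\pi i)^{-2l}\sum_{(a,b)\ne(0,0)}(a\tau+b)^{-2l}$ for $l\ge1$ (for $l=1$ summed first over $b$, then over $a$). Let $O_q(U)$ be the $M(\Gamma(1))$-submodule of $M(\Gamma(1))\otimes U$ generated by all $v[0]u$ and all $v[-2]u+\sum_{l\ge2}(2l-1)E_{2l}\otimes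 v[2l-2]u$ ($v\in V$, $u\in U$). Let $C_1(U)$ be the space of all functions $S:(M(\Gamma(1))\otimes U)\times\mathcal H\to\mathbb C$ such that $S(x,\tau)$ is holomorphic in $\tau$ and $M(\Gamma(1))$-linear in $x$, vanishes for $x\in O_q(U)$, and satisfies, for all $k$ and $u\in U_{[k]}$, $$S(L[-2]u,\tau)=\frac1{2\pi i}\frac{d}{d\tau}S(u,\tau)+kE_2(\tau)S(u,\tau)+\sum_{l\ge2}E_{2l}(\tau)S(L[2l-2]u,\tau).$$ All powers below are principal branches. Then: (1) There is exactly one representation $\rho$ of $SL(2,\mathbb Z)$ on $C_1(U)$ such that for $S\in C_1(U)$, $u\in U_{[k]}$, $\tau\in\mathcal H$ $$\Big(\rho\begin{pmatrix}0&-1\\1&0\end{pmatrix}S\Big)(u,\tau)=(-i\tau)^{-t}\tau^{t-k}S(u,-1/\tau),\qquad \Big(\rho\begin{pmatrix}1&1\\0&1\end{pmatrix}S\Big)(u,\tau)=i^{-t/3}S(u,\tau+1).$$ (2) If $k-t\in2\mathbb Z$ and $u\in U_{[k]}$, then also $\Big(\rho\begin{pmatrix}0&1\\-1&0\end{pmatrix}S\Big)(u,\tau)=(-i\tau)^{-t}\tau^{t-k}S(u,-1/\tau)$.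 (3) As a result, spanning families of one-point functions are vector-valued modular forms of weight $k$: there is a multiplier system $\nu:SL(2,\mathbb Z)\to\{|z|=1\}$ of weight $t$ (that is, $\nu(\gamma)(c\tau+d)^t$ is an automorphy factor) with $\nu\begin{pmatrix}0&-1\\1&0\end{pmatrix}=i^{-t}$ and $\nu\begin{pmatrix}1&1\\0&1\end{pmatrix}=i^{t/3}$ such that whenever $S_1,\dots,S_N$ span $C_1(U)$, there is a homomorphism $R:SL(2,\mathbb Z)\to GL_N(\mathbb C)$ with $$S_i\Big(u,\frac{a\tau+b}{c\tau+d}\Big)=\nu(\gamma)(c\tau+d)^k\sum_{j=1}^N R(\gamma)_{ij}S_j(u,\tau)$$ for all $\gamma=\begin{pmatrix}a&b\\c&d\end{pmatrix}\in SL(2,\mathbb Z)$, $\tau\in\mathcal H$, $1\le i\le N$, all $k$ and all $u\in U_{[k]}$. -/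

import Mathlib

open scoped TensorProduct MatrixGroups UpperHalfPlane Manifold

noncomputable section

/-! ### Vertex operator algebras and their modules -/

/-- A vertex operator algebra over `ℂ`.  `mode n v w` is `v(n) w`, i.e. `Y(v,z) = ∑ₙ v(n) z^{-n-1}`.
The Jacobi identity (equivalently: commutativity and associativity) is stated in components.
The weight spaces are `V_n = {v | L(0) v = n v}`, where `L(n) = ω(n+1)`. -/
structure VertexOperatorAlgebra (V : Type*) [AddCommGroup V] [Module ℂ V] where
  mode : ℤ → V →ₗ[ℂ] V →ₗ[ℂ] V
  vac : V
  conf : V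
  centralCharge : ℂ
  truncation : ∀ v w : V, ∃ N : ℤ, ∀ n : ℤ, N ≤ n → mode n v w = 0
  vac_mode : ∀ (n : ℤ) (v : V), mode n vac v = if n = -1 then v else 0
  creation : ∀ v : V, mode (-1) v vac = v
  creation_nonneg : ∀ (v : V) (n : ℤ), 0 ≤ n → mode n v vac = 0
  jacobi : ∀ (l m n : ℤ) (u v w : V),
    ∑ᶠ j : ℕ, ((Ring.choose m j : ℤ) : ℂ) • mode (m + n - j) (mode (l + j) u v) w =
      ∑ᶠ j : ℕ, ((-1 : ℂ) ^ j * ((Ring.choose l j : ℤ) : ℂ)) •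
        (mode (m + l - j) u (mode (n + j) v w)
          - (-1 : ℂ) ^ l • mode (n + l - j) v (mode (m + j) u w))
  virasoro : ∀ (m n : ℤ) (v : V),
    mode (m + 1) conf (mode (n + 1) conf v) - mode (n + 1) conf (mode (m + 1) conf v) =
      ((m : ℂ) - n) • mode (m + n + 1) conf v
        + (if m + n = 0 then ((m : ℂ) ^ 3 - m) / 12 * centralCharge else 0) • v
  translation : ∀ (n : ℤ) (v w : V),
    mode n (mode 0 conf v) w = -(n : ℂ) • mode (n - 1) v w
  isInternal : DirectSum.IsInternal
    fun n : ℤ => Module.End.eigenspace (mode 1 conf) (n : ℂ)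
  finiteDimensional : ∀ n : ℤ,
    FiniteDimensional ℂ (Module.End.eigenspace (mode 1 conf) (n : ℂ))
  bounded_below : ∃ N : ℤ, ∀ n : ℤ, n < N →
    Module.End.eigenspace (mode 1 conf) (n : ℂ) = ⊥
  vac_weight : mode 1 conf vac = 0
  conf_weight : mode 1 conf conf = (2 : ℂ) • conf

namespace VertexOperatorAlgebra

variable {V : Type*} [AddCommGroup V] [Module ℂ V]

/-- The projection of `V = ⨁ V_n` onto the weight space `V_p`. -/
def proj (A : VertexOperatorAlgebra V) (p : ℤ) : V →ₗ[ℂ] V :=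
  (Module.End.eigenspace (A.mode 1 A.conf) (p : ℂ)).subtype ∘ₗ
    DirectSum.component ℂ ℤ (fun n : ℤ => Module.End.eigenspace (A.mode 1 A.conf) (n : ℂ)) p ∘ₗ
    (LinearEquiv.ofBijective (DirectSum.coeLinearMap
      fun n : ℤ => Module.End.eigenspace (A.mode 1 A.conf) (n : ℂ)) A.isInternal).symm.toLinearMap

/-- The second conformal vector `ω̃ = ω - c/24`. -/
def confTilde (A : VertexOperatorAlgebra V) : V := A.conf - (A.centralCharge / 24) • A.vac

end VertexOperatorAlgebra

/-- A module `U = ⨁_{n ≥ 0} U_{r+n}` with finite-dimensional weight spaces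
`U_s = {u | L(0) u = s u}` over a vertex operator algebra `A`; here `r` is `lowestWeight`.
Every irreducible module is of this form.  `mode n v u` is `v(n) u`. -/
structure VOAModule {V : Type*} [AddCommGroup V] [Module ℂ V] (A : VertexOperatorAlgebra V)
    (U : Type*) [AddCommGroup U] [Module ℂ U] where
  mode : ℤ → V →ₗ[ℂ] U →ₗ[ℂ] U
  lowestWeight : ℂ
  truncation : ∀ (v : V) (u : U), ∃ N : ℤ, ∀ n : ℤ, N ≤ n → mode n v u = 0
  vac_mode : ∀ (n : ℤ) (u : U), mode n A.vac u = if n = -1 then u else 0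
  jacobi : ∀ (l m n : ℤ) (a b : V) (u : U),
    ∑ᶠ j : ℕ, ((Ring.choose m j : ℤ) : ℂ) • mode (m + n - j) (A.mode (l + j) a b) u =
      ∑ᶠ j : ℕ, ((-1 : ℂ) ^ j * ((Ring.choose l j : ℤ) : ℂ)) •
        (mode (m + l - j) a (mode (n + j) b u)
          - (-1 : ℂ) ^ l • mode (n + l - j) b (mode (m + j) a u))
  virasoro : ∀ (m n : ℤ) (u : U),
    mode (m + 1) A.conf (mode (n + 1) A.conf u) - mode (n + 1) A.conf (mode (m + 1) A.conf u) =
      ((m : ℂ) - n) • mode (m + n + 1) A.conf u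
        + (if m + n = 0 then ((m : ℂ) ^ 3 - m) / 12 * A.centralCharge else 0) • u
  translation : ∀ (n : ℤ) (v : V) (u : U),
    mode n (A.mode 0 A.conf v) u = -(n : ℂ) • mode (n - 1) v u
  isInternal : DirectSum.IsInternal
    fun n : ℕ => Module.End.eigenspace (mode 1 A.conf) (lowestWeight + n)
  finiteDimensional : ∀ n : ℕ,
    FiniteDimensional ℂ (Module.End.eigenspace (mode 1 A.conf) (lowestWeight + n))

/-- The coefficient of `z^i` in the Laurent series `(log(1+z))^m (1+z)^{p-1}`. -/
def squareCoeff (p m i : ℤ) : ℂ :=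
  (((PowerSeries.log ℂ : PowerSeries ℂ) : LaurentSeries ℂ) ^ m *
    ((1 + PowerSeries.X : PowerSeries ℂ) : LaurentSeries ℂ) ^ (p - 1)).coeff i

namespace VOAModule

variable {V : Type*} [AddCommGroup V] [Module ℂ V] {A : VertexOperatorAlgebra V}
  {U : Type*} [AddCommGroup U] [Module ℂ U]

/-- The modes `v[m] u` of `Y[v,z] = Y(v, e^z - 1) e^{z wt(v)} = ∑ v[m] z^{-m-1}`, that is
`v[m] = Res_z Y(v,z) (log(1+z))^m (1+z)^{wt(v)-1}` for homogeneous `v`, extended linearly. -/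
def sqMode (M : VOAModule A U) (v : V) (m : ℤ) (u : U) : U :=
  ∑ᶠ p : ℤ, ∑ᶠ i : ℤ, squareCoeff p m i • M.mode i (A.proj p v) u

/-- `L[n]`, where `Y[ω̃,z] = ∑ L[n] z^{-n-2}`. -/
def sqL (M : VOAModule A U) (n : ℤ) (u : U) : U := M.sqMode A.confTilde (n + 1) u

/-- `U_[k] = {u | L[0] u = k u}`. -/
def sqWeight (M : VOAModule A U) (k : ℂ) : Set U := {u | M.sqL 0 u = k • u}

end VOAModule

/-! ### Modular forms on `SL(2,ℤ)` and Eisenstein series -/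

/-- The ring `M(Γ(1))` of holomorphic modular forms on `SL(2,ℤ)` (sums of forms of
various weights), as a ring of functions on the upper half-plane. -/
def modularRing : Subalgebra ℂ (ℍ → ℂ) :=
  Algebra.adjoin ℂ {f | ∃ (k : ℤ) (F : ModularForm 𝒮ℒ k), f = ⇑F}

/-- `2 n + 4 ≥ 3`. -/
theorem three_le_two_mul_add_four (n : ℕ) : 3 ≤ 2 * n + 4 := by omega

/-- `E_{2n+4}(τ) = (2πi)^{-(2n+4)} G_{2n+4}(τ)` as an element of the ring of modular forms. -/
def eisen (n : ℕ) : modularRing :=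
  ⟨(((2 * Real.pi * Complex.I : ℂ) ^ (2 * n + 4))⁻¹ * (2 * riemannZeta ((2 * n + 4 : ℕ) : ℂ))) •
      ⇑(ModularForm.E (three_le_two_mul_add_four n)),
    modularRing.smul_mem (Algebra.subset_adjoin ⟨_, _, rfl⟩) _⟩

/-- `eisen n` is the lattice sum `(2πi)^{-k} ∑_{(a,b) ≠ (0,0)} (aτ+b)^{-k}`, `k = 2n+4`; the term
`(a,b) = (0,0)` of the sum below is zero. -/
theorem eisen_apply (n : ℕ) (τ : ℍ) : (eisen n : ℍ → ℂ) τ =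
    ((2 * Real.pi * Complex.I : ℂ) ^ (2 * n + 4))⁻¹ *
      ∑' v : Fin 2 → ℤ, ((v 0 : ℂ) * τ + v 1) ^ (-((2 * n + 4 : ℕ) : ℤ)) := by
  have h := tsum_eisSummand_eq_riemannZeta_mul_eisensteinSeries
    (three_le_two_mul_add_four n) τ
  have hE : ModularForm.E (three_le_two_mul_add_four n) τ =
    (1 / 2 : ℂ) * eisensteinSeries (N := 1) 0 ((2 * n + 4 : ℕ) : ℤ) τ := rfl
  simp only [EisensteinSeries.eisSummand] at h
  rw [h]
  simp only [eisen, Pi.smul_apply, smul_eq_mul, hE]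
  ring

/-- `E_2(τ) = (2πi)^{-2} G_2(τ)`, with `G_2(τ) = ∑_a ∑_b (aτ+b)^{-2}`
(the term `(0,0)` omitted, the inner sum over `b` taken first). -/
def eisenTwo (τ : ℍ) : ℂ := ((2 * Real.pi * Complex.I : ℂ) ^ 2)⁻¹ * EisensteinSeries.G2 τ

/-! ### One-point functions on the torus -/

namespace VOAModule

variable {V : Type*} [AddCommGroup V] [Module ℂ V] {A : VertexOperatorAlgebra V}
  {U : Type*} [AddCommGroup U] [Module ℂ U]

/-- `O_q(U)`: the `M(Γ(1))`-submodule of `M(Γ(1)) ⊗ U` generated by the elements `v[0]u` and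
`v[-2]u + ∑_{k ≥ 2} (2k-1) E_{2k}(τ) ⊗ v[2k-2]u`; the sum is indexed by `n = k - 2`. -/
def Oq (M : VOAModule A U) : Submodule modularRing (modularRing ⊗[ℂ] U) :=
  Submodule.span modularRing
    ({x | ∃ (v : V) (u : U), x = (1 : modularRing) ⊗ₜ[ℂ] M.sqMode v 0 u} ∪
     {x | ∃ (v : V) (u : U), x = (1 : modularRing) ⊗ₜ[ℂ] M.sqMode v (-2) u +
        ∑ᶠ n : ℕ, ((2 * n + 3 : ℕ) : ℂ) • (eisen n ⊗ₜ[ℂ] M.sqMode v (2 * n + 2) u)})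

/-- The space `C_1(U)` of one-point functions on `U`: the functions
`S : (M(Γ(1)) ⊗ U) × ℍ → ℂ`, linear in the first variable, which are
(1) holomorphic in `τ`, (2) `M(Γ(1))`-linear, (3) zero on `O_q(U)`, and which satisfy
(4) `S(L[-2]u, τ) = (2πi)⁻¹ dS(u,τ)/dτ + k E_2(τ) S(u,τ) + ∑_{l ≥ 2} E_{2l}(τ) S(L[2l-2]u, τ)`
for `u ∈ U_[k]`; by (2), the sum is `S(∑ E_{2l} ⊗ L[2l-2]u, τ)`, and it is indexed by `n = l - 2`. -/
def onePoint (M : VOAModule A U) : Submodule ℂ ((modularRing ⊗[ℂ] U) →ₗ[ℂ] (ℍ → ℂ)) where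
  carrier := {S |
    (∀ x, MDiff (S x)) ∧
    (∀ (f : modularRing) (x : modularRing ⊗[ℂ] U) (τ : ℍ),
      S (f • x) τ = (f : ℍ → ℂ) τ * S x τ) ∧
    (∀ x ∈ M.Oq, ∀ τ : ℍ, S x τ = 0) ∧
    (∀ (k : ℂ), ∀ u ∈ M.sqWeight k, ∀ τ : ℍ,
      S (1 ⊗ₜ[ℂ] M.sqL (-2) u) τ =
        Derivative.normalizedDerivOfComplex (S (1 ⊗ₜ[ℂ] u)) τ
          + k * eisenTwo τ * S (1 ⊗ₜ[ℂ] u) τ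
          + S (∑ᶠ n : ℕ, eisen n ⊗ₜ[ℂ] M.sqL (2 * n + 2) u) τ)}
  add_mem' := by
    rintro S T ⟨hS1, hS2, hS3, hS4⟩ ⟨hT1, hT2, hT3, hT4⟩
    refine ⟨fun x => (hS1 x).add (hT1 x), fun f x τ => ?_, fun x hx τ => ?_, fun k u hu τ => ?_⟩
    · simp only [LinearMap.add_apply, Pi.add_apply, hS2, hT2]; ring
    · simp [hS3 x hx τ, hT3 x hx τ]
    · simp only [LinearMap.add_apply, hS4 k u hu τ, hT4 k u hu τ, Pi.add_apply,
        Derivative.normalizedDerivOfComplex_add _ _ (hS1 _) (hT1 _)]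
      ring
  zero_mem' := by
    refine ⟨fun x => ?_, fun f x τ => by simp, fun x hx τ => by simp, fun k u hu τ => ?_⟩
    · exact mdifferentiable_const (c := (0 : ℂ))
    · have h := congrFun (Derivative.normalizedDerivOfComplex_const (0 : ℂ)) τ
      simp only [LinearMap.zero_apply, Pi.zero_apply, mul_zero, add_zero]
      exact h.symm
  smul_mem' := by
    rintro c S ⟨hS1, hS2, hS3, hS4⟩
    refine ⟨fun x => (hS1 x).const_smul c, fun f x τ => ?_, fun x hx τ => ?_, fun k u hu τ => ?_⟩
    · simp only [LinearMap.smul_apply, Pi.smul_apply, hS2, smul_eq_mul]; ring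
    · simp [hS3 x hx τ]
    · simp only [LinearMap.smul_apply, hS4 k u hu τ, Pi.smul_apply, smul_eq_mul,
        Derivative.normalizedDerivOfComplex_smul _ _ (hS1 _)]
      ring

/-- The value `S(u, τ)` of a one-point function at `u = 1 ⊗ u`, `u ∈ U`. -/
def eval (M : VOAModule A U) (S : M.onePoint) (u : U) (τ : ℍ) : ℂ :=
  (S : (modularRing ⊗[ℂ] U) →ₗ[ℂ] (ℍ → ℂ)) (1 ⊗ₜ[ℂ] u) τ

/-- The representation `ρ` of `SL(2,ℤ)` on `C_1(U)` is given by, for `u ∈ U_[k]`,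
`ρ (0 -1; 1 0) S (u, τ) = (-iτ)^{-t} τ^{t-k} S(u, -1/τ)` and
`ρ (1 1; 0 1) S (u, τ) = i^{-t/3} S(u, τ+1)`, with principal branches.
The matrices `ModularGroup.S = (0 -1; 1 0)`, `ModularGroup.T = (1 1; 0 1)` act on `ℍ` by
`τ ↦ -1/τ` and `τ ↦ τ + 1`. -/
def IsModularAction (M : VOAModule A U) (t : ℝ)
    (ρ : Representation ℂ SL(2, ℤ) M.onePoint) : Prop :=
  (∀ (S : M.onePoint) (k : ℂ), ∀ u ∈ M.sqWeight k, ∀ τ : ℍ,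
    M.eval (ρ ModularGroup.S S) u τ =
      (-Complex.I * (τ : ℂ)) ^ (-(t : ℂ)) * (τ : ℂ) ^ ((t : ℂ) - k) *
        M.eval S u (ModularGroup.S • τ)) ∧
  (∀ (S : M.onePoint) (u : U) (τ : ℍ),
    M.eval (ρ ModularGroup.T S) u τ =
      Complex.I ^ (-(t : ℂ) / 3) * M.eval S u (ModularGroup.T • τ))

end VOAModule

/-- `ν` is a multiplier system of real weight `w` on `SL(2,ℤ)`: a map to the unit circle such that
`ν(γ) (cτ+d)^w` (principal branch) is an automorphy factor. -/
def IsMultiplierSystem (w : ℝ) (ν : SL(2, ℤ) → ℂ) : Prop :=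
  (∀ γ, ‖ν γ‖ = 1) ∧
  ∀ (γ δ : SL(2, ℤ)) (τ : ℍ),
    ν (γ * δ) * ((((γ * δ) 1 0 : ℤ) : ℂ) * τ + (((γ * δ) 1 1 : ℤ) : ℂ)) ^ (w : ℂ) =
      (ν γ * (((γ 1 0 : ℤ) : ℂ) * ((δ • τ : ℍ) : ℂ) + ((γ 1 1 : ℤ) : ℂ)) ^ (w : ℂ)) *
        (ν δ * (((δ 1 0 : ℤ) : ℂ) * (τ : ℂ) + ((δ 1 1 : ℤ) : ℂ)) ^ (w : ℂ))

end

/-! The weights of $L[0]$ on $U$ lie in $r+\mathbb N\subset t+\mathbb Z$, so the only obstacle to an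
honest modular action is the non-integral part $t$. It is absorbed by a power of the eta function.
Choose `ℓ` on the upper half-plane with $\frac1{2\pi i}\ell'=E_2^{\mathrm{norm}}/12$, where
$E_2^{\mathrm{norm}}=1-24q-\dots$. Up to a constant `ℓ` is $2\log\eta$, and $e^{t\ell}$ behaves like
a form of weight $t$. For $u$ of weight $k$ put
$(S|\gamma)(u,\tau)=e^{t(\ell(\tau)-\ell(\gamma\tau))}(c\tau+d)^{-(k-t)}S(u,\gamma\tau)$. Here $k-t$
is an integer, the exponential telescopes and $c\tau+d$ is a cocycle, so this is a right action
(`exists_slash`).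

It preserves $C_1(U)$ (`slashMap_mem_onePoint`) for two reasons. First, $v[n]$ shifts $L[0]$-weights
by $h-n-1$ when $L[0]v=hv$, and $E_{2l}$ has weight $2l$; hence each generator of $O_q(U)$ and each
Eisenstein sum is homogeneous when $v,u$ are (`sqLZero_commutator`, `slashMap_oq`). Second,
condition (4) expresses the Serre derivative of $S(u,\cdot)$ in weight $k$, and Serre derivatives
commute with the twisted slash (`serreDerivative_twisted_slash`). Since $L[0]=L(0)+\text{(weight
lowering)}$ is diagonalizable (`iSup_eigenspace_sqLZero`), homogeneous vectors suffice.

The principal branches in the statement come from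
$\ell(\gamma\tau)=\ell(\tau)+\log(c\tau+d)+\kappa(\gamma)$, with $\kappa$ computed at elliptic fixed
points (`exists_logEta`). The multiplier system is $\nu=e^{t\kappa}$. The right action becomes a
representation through the anti-automorphism `swapDiag`, which fixes both generators; these
generators also give uniqueness. Part (2) is $S^{-1}=S^3$, and part (3) writes the right action in a
spanning family (`exists_GL_of_rightAction`). -/

noncomputable section

/-- The coefficientwise algebra structure, which is compatible with `HahnSeries.instModule`. -/
instance laurentAlgebra : Algebra ℂ (LaurentSeries ℂ) := HahnSeries.instAlgebra

instance laurentIsScalarTower : @IsScalarTower ℂ (LaurentSeries ℂ) (LaurentSeries ℂ)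
    HahnSeries.instSMul _ HahnSeries.instSMul where
  smul_assoc c f g := by
    rw [← HahnSeries.C_mul_eq_smul, ← HahnSeries.C_mul_eq_smul, smul_eq_mul, smul_eq_mul, mul_assoc]

instance laurentSMulCommClass : @SMulCommClass ℂ (LaurentSeries ℂ) (LaurentSeries ℂ)
    HahnSeries.instSMul _ where
  smul_comm c f g := by
    rw [← HahnSeries.C_mul_eq_smul, ← HahnSeries.C_mul_eq_smul, smul_eq_mul, smul_eq_mul]
    ring

/-! ### Residues against truncated sequences -/

/-- `Res_z f(z) ∑ y_i z^{-i-1}` for a Laurent series `f` and a sequence `y`. -/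
def seqRes {W : Type*} [AddCommGroup W] [Module ℂ W] (f : LaurentSeries ℂ) (y : ℤ → W) : W :=
  ∑ᶠ i : ℤ, f.coeff i • y i

section seqRes

variable {W : Type*} [AddCommGroup W] [Module ℂ W]

theorem seqRes_support_finite (f : LaurentSeries ℂ) {y : ℤ → W}
    (hy : ∃ N, ∀ n, N ≤ n → y n = 0) : (Function.support fun i => f.coeff i • y i).Finite := by
  obtain ⟨N, hN⟩ := hy
  refine (Set.finite_Ico f.order N).subset fun i hi => ?_
  constructor
  · by_contra h
    exact hi (by simp [HahnSeries.coeff_eq_zero_of_lt_order (not_le.mp h)])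
  · by_contra h
    exact hi (by simp [hN i (not_lt.mp h)])

theorem seqRes_add_left (f g : LaurentSeries ℂ) {y : ℤ → W}
    (hy : ∃ N, ∀ n, N ≤ n → y n = 0) : seqRes (f + g) y = seqRes f y + seqRes g y := by
  simp only [seqRes]
  rw [← finsum_add_distrib (seqRes_support_finite f hy) (seqRes_support_finite g hy)]
  simp [add_smul]

theorem seqRes_smul_left (c : ℂ) (f : LaurentSeries ℂ) {y : ℤ → W}
    (hy : ∃ N, ∀ n, N ≤ n → y n = 0) : seqRes (c • f) y = c • seqRes f y := by
  simp only [seqRes]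
  rw [smul_finsum' _ (seqRes_support_finite f hy)]
  simp [smul_smul]

theorem seqRes_add_right (f : LaurentSeries ℂ) {y z : ℤ → W}
    (hy : ∃ N, ∀ n, N ≤ n → y n = 0) (hz : ∃ N, ∀ n, N ≤ n → z n = 0) :
    seqRes f (fun i => y i + z i) = seqRes f y + seqRes f z := by
  simp only [seqRes]
  rw [← finsum_add_distrib (seqRes_support_finite f hy) (seqRes_support_finite f hz)]
  simp [smul_add]

theorem seqRes_smul_right (c : ℂ) (f : LaurentSeries ℂ) {y : ℤ → W}
    (hy : ∃ N, ∀ n, N ≤ n → y n = 0) : seqRes f (fun i => c • y i) = c • seqRes f y := by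
  simp only [seqRes]
  rw [smul_finsum' _ (seqRes_support_finite f hy)]
  simp [smul_comm c]

theorem seqRes_single (n : ℤ) (c : ℂ) (y : ℤ → W) :
    seqRes (HahnSeries.single n c) y = c • y n := by
  rw [seqRes, finsum_eq_single _ n]
  · simp
  · intro i hi
    simp [HahnSeries.coeff_single_of_ne hi]

theorem seqRes_eq_zero {f : LaurentSeries ℂ} {y : ℤ → W} {N : ℤ}
    (hf : ∀ i, i < N → f.coeff i = 0) (hy : ∀ n, N ≤ n → y n = 0) : seqRes f y = 0 := by
  refine finsum_eq_zero_of_forall_eq_zero fun i => ?_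
  rcases lt_or_ge i N with h | h
  · simp [hf i h]
  · simp [hy i h]

end seqRes

/-! ### Calculus of Laurent series and the series $(\log(1+z))^n(1+z)^{p-1}$. -/

/-- A linear functional of Laurent series that kills all monomials and all series of high order
is zero. -/
theorem laurentFunctional_eq_zero {W : Type*} [AddCommGroup W] [Module ℂ W]
    (Φ : LaurentSeries ℂ →ₗ[ℂ] W)
    (hcont : ∃ B : ℤ, ∀ f : LaurentSeries ℂ, (∀ i, i < B → f.coeff i = 0) → Φ f = 0)
    (hmono : ∀ n : ℤ, Φ (HahnSeries.single n 1) = 0) (f : LaurentSeries ℂ) : Φ f = 0 := by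
  obtain ⟨B, hB⟩ := hcont
  -- The part of `f` below degree `B` is a finite combination of monomials; the rest has order at
  -- least `B`.
  set s : LaurentSeries ℂ := ∑ i ∈ Finset.Ico f.order B, f.coeff i • HahnSeries.single i 1 with hs
  have h1 : Φ s = 0 := by
    rw [hs, map_sum]
    exact Finset.sum_eq_zero fun i _ => by rw [map_smul, hmono, smul_zero]
  have h2 : Φ (f - s) = 0 := by
    refine hB _ fun i hi => ?_
    have hcoeff : s.coeff i = ∑ j ∈ Finset.Ico f.order B, if i = j then f.coeff j else 0 := by
      rw [hs, HahnSeries.coeff_sum]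
      refine Finset.sum_congr rfl fun j _ => ?_
      rw [HahnSeries.coeff_smul, HahnSeries.coeff_single]
      split_ifs <;> simp
    rw [HahnSeries.coeff_sub, hcoeff, Finset.sum_ite_eq]
    split_ifs with h
    · simp
    · rw [HahnSeries.coeff_eq_zero_of_lt_order]
      · simp
      · by_contra h'
        exact h (Finset.mem_Ico.mpr ⟨not_lt.mp h', hi⟩)
  rw [map_sub, h1, sub_zero] at h2
  exact h2

theorem LaurentSeries.coeff_mul_eq_zero_of_lt {f g : LaurentSeries ℂ} {a b i : ℤ}
    (hf : ∀ j, j < a → f.coeff j = 0) (hg : ∀ j, j < b → g.coeff j = 0) (hi : i < a + b) :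
    (f * g).coeff i = 0 := by
  rw [HahnSeries.coeff_mul]
  refine Finset.sum_eq_zero fun p hp => ?_
  rw [Finset.mem_antidiagonal] at hp
  by_cases h : p.1 < a
  · rw [hf _ h, zero_mul]
  · rw [hg p.2 (by linarith [hp.2.2, not_lt.mp h]), mul_zero]

/-- The Leibniz rule for the derivative of Laurent series. -/
theorem LaurentSeries.hasseDeriv_one_mul (f g : LaurentSeries ℂ) :
    LaurentSeries.hasseDeriv ℂ 1 (f * g) =
      f * LaurentSeries.hasseDeriv ℂ 1 g + g * LaurentSeries.hasseDeriv ℂ 1 f := by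
  let Φ : LaurentSeries ℂ →ₗ[ℂ] LaurentSeries ℂ :=
    LaurentSeries.hasseDeriv ℂ 1 ∘ₗ LinearMap.mulRight ℂ g
      - LinearMap.mulRight ℂ (LaurentSeries.hasseDeriv ℂ 1 g)
      - LinearMap.mulLeft ℂ g ∘ₗ LaurentSeries.hasseDeriv ℂ 1
  have key : Φ f = 0 := by
    ext N
    let coeffN : LaurentSeries ℂ →ₗ[ℂ] ℂ :=
      { toFun := fun h => h.coeff N, map_add' := fun _ _ => rfl, map_smul' := fun _ _ => rfl }
    have h0 : ∀ j, j < g.order → g.coeff j = 0 :=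
      fun j hj => HahnSeries.coeff_eq_zero_of_lt_order hj
    have h0' : ∀ j, j < g.order - 1 → (LaurentSeries.hasseDeriv ℂ 1 g).coeff j = 0 := by
      intro j hj
      rw [LaurentSeries.hasseDeriv_coeff, h0 _ (by push_cast; linarith), smul_zero]
    -- For one fixed coefficient `N` all three products vanish once `f` has large order; this bound
    -- depends on `N`, so the coefficients are treated one at a time. Only monomials `f` remain.
    refine laurentFunctional_eq_zero (coeffN ∘ₗ Φ) ⟨N + 2 - g.order, fun f hf => ?_⟩
      (fun n => ?_) f
    · have hf' : ∀ j, j < N + 1 - g.order → (LaurentSeries.hasseDeriv ℂ 1 f).coeff j = 0 := by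
        intro j hj
        rw [LaurentSeries.hasseDeriv_coeff, hf _ (by push_cast; linarith), smul_zero]
      have e1 : (f * g).coeff (N + 1) = 0 :=
        LaurentSeries.coeff_mul_eq_zero_of_lt hf h0 (by linarith)
      have e2 : (f * LaurentSeries.hasseDeriv ℂ 1 g).coeff N = 0 :=
        LaurentSeries.coeff_mul_eq_zero_of_lt hf h0' (by linarith)
      have e3 : (g * LaurentSeries.hasseDeriv ℂ 1 f).coeff N = 0 :=
        LaurentSeries.coeff_mul_eq_zero_of_lt h0 hf' (by linarith)
      simp [coeffN, Φ, e1, e2, e3]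
    · simp only [coeffN, Φ, LinearMap.comp_apply, LinearMap.coe_mk, AddHom.coe_mk,
        LinearMap.sub_apply, LinearMap.mulRight_apply, LinearMap.mulLeft_apply,
        HahnSeries.coeff_sub, LaurentSeries.hasseDeriv_coeff, LaurentSeries.hasseDeriv_single,
        Ring.choose_one_right, HahnSeries.coeff_single_mul, HahnSeries.coeff_mul_single]
      push_cast
      have e1 : N + 1 - n = N - n + 1 := by ring
      have e2 : N - (n - 1) = N - n + 1 := by ring
      rw [e1, e2]
      simp only [zsmul_eq_mul]
      push_cast
      ring
  have := sub_eq_zero.mp (show _ - _ = (0 : LaurentSeries ℂ) from key)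
  simp only [LinearMap.sub_apply, LinearMap.comp_apply, LinearMap.mulRight_apply,
    LinearMap.mulLeft_apply] at this
  rw [sub_eq_iff_eq_add] at this
  rw [this]; ring

/-- The derivative of Laurent series as a derivation. -/
def laurentDerivation : Derivation ℂ (LaurentSeries ℂ) (LaurentSeries ℂ) :=
  Derivation.mk' (LaurentSeries.hasseDeriv ℂ 1) fun f g => by
    simp only [LaurentSeries.hasseDeriv_one_mul, smul_eq_mul]

theorem laurentDerivation_apply (f : LaurentSeries ℂ) :
    laurentDerivation f = LaurentSeries.hasseDeriv ℂ 1 f := rfl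

theorem laurentDerivation_coe (f : PowerSeries ℂ) :
    laurentDerivation (f : LaurentSeries ℂ) =
      ((PowerSeries.derivative ℂ f : PowerSeries ℂ) : LaurentSeries ℂ) := by
  ext n
  rw [laurentDerivation_apply, LaurentSeries.hasseDeriv_coeff, PowerSeries.coeff_coe,
    PowerSeries.coeff_coe, Ring.choose_one_right]
  rcases lt_trichotomy n (-1) with h | h | h
  · rw [if_pos (by push_cast; omega), if_pos (by omega), smul_zero]
  · subst h; simp
  · obtain ⟨k, rfl⟩ := Int.eq_ofNat_of_zero_le (show 0 ≤ n by omega)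
    rw [if_neg (by push_cast; omega), if_neg (by omega)]
    have : ((k : ℤ) + ((1 : ℕ) : ℤ)).natAbs = k + 1 := by omega
    rw [this, Int.natAbs_natCast, PowerSeries.coeff_derivative]
    simp only [zsmul_eq_mul]
    push_cast; ring

/-- The Laurent series of `log(1+z)`. -/
def laurentLog : LaurentSeries ℂ := ((PowerSeries.log ℂ : PowerSeries ℂ) : LaurentSeries ℂ)

/-- The Laurent series `1+z`. -/
def laurentOneAdd : LaurentSeries ℂ := ((1 + PowerSeries.X : PowerSeries ℂ) : LaurentSeries ℂ)

theorem PowerSeries.one_add_X_constantCoeff_ne_zero :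
    PowerSeries.constantCoeff (1 + PowerSeries.X : PowerSeries ℂ) ≠ 0 := by simp

theorem laurentOneAdd_inv :
    laurentOneAdd⁻¹ = (((1 + PowerSeries.X : PowerSeries ℂ)⁻¹ : PowerSeries ℂ) : LaurentSeries ℂ) := by
  symm
  apply eq_inv_of_mul_eq_one_left
  rw [laurentOneAdd, ← PowerSeries.coe_mul,
    PowerSeries.inv_mul_cancel _ PowerSeries.one_add_X_constantCoeff_ne_zero, PowerSeries.coe_one]

theorem laurentOneAdd_ne_zero : laurentOneAdd ≠ 0 := by
  intro h
  have := congrArg (fun f : LaurentSeries ℂ => f.coeff 0) h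
  simp [laurentOneAdd] at this

theorem laurentDerivation_oneAdd : laurentDerivation laurentOneAdd = 1 := by
  rw [laurentOneAdd, laurentDerivation_coe]
  simp

theorem laurentDerivation_log : laurentDerivation laurentLog = laurentOneAdd⁻¹ := by
  rw [laurentLog, laurentDerivation_coe, laurentOneAdd_inv]
  congr 1
  rw [PowerSeries.eq_inv_iff_mul_eq_one PowerSeries.one_add_X_constantCoeff_ne_zero]
  rw [PowerSeries.deriv_log, mul_add, mul_one]
  ext n
  rcases n with _ | n
  · simp
  · simp [PowerSeries.coeff_succ_mul_X, PowerSeries.coeff_one, pow_succ]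

theorem laurentDerivation_oneAdd_zpow (p : ℤ) :
    laurentDerivation (laurentOneAdd ^ p) = (p : ℂ) • laurentOneAdd ^ (p - 1) := by
  rw [Derivation.leibniz_zpow, laurentDerivation_oneAdd]
  simp [← Int.cast_smul_eq_zsmul ℂ]

/-- The Laurent series `(log(1+z))^n (1+z)^{p-1}`. -/
def sqSeries (p n : ℤ) : LaurentSeries ℂ := laurentLog ^ n * laurentOneAdd ^ (p - 1)

theorem laurentLog_ne_zero : laurentLog ≠ 0 := by
  intro h
  have := congrArg (fun f : LaurentSeries ℂ => f.coeff 1) h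
  simp [laurentLog, PowerSeries.coeff_coe] at this

theorem laurentLog_coeff_of_lt {i : ℤ} (hi : i < 1) : laurentLog.coeff i = 0 := by
  rw [laurentLog, PowerSeries.coeff_coe]
  split_ifs with h
  · rfl
  · have : i = 0 := by omega
    subst this; simp

theorem laurentLog_coeff_one : laurentLog.coeff 1 = 1 := by
  rw [laurentLog, PowerSeries.coeff_coe]
  simp

theorem laurentLog_order : laurentLog.order = 1 := by
  refine le_antisymm (HahnSeries.order_le_of_coeff_ne_zero (by simp [laurentLog_coeff_one])) ?_
  by_contra h
  exact HahnSeries.coeff_order_eq_zero.not.mpr laurentLog_ne_zero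
    (laurentLog_coeff_of_lt (not_le.mp h))

theorem laurentOneAdd_order : laurentOneAdd.order = 0 := by
  have h0 : laurentOneAdd.coeff 0 = 1 := by simp [laurentOneAdd]
  refine le_antisymm (HahnSeries.order_le_of_coeff_ne_zero (by simp [h0])) ?_
  by_contra h
  refine HahnSeries.coeff_order_eq_zero.not.mpr laurentOneAdd_ne_zero ?_
  have hcoe : ∀ i : ℤ, i < 0 → laurentOneAdd.coeff i = 0 := fun i hi => by
    rw [laurentOneAdd, PowerSeries.coeff_coe, if_pos hi]
  exact hcoe _ (not_le.mp h)

theorem LaurentSeries.order_zpow (f : LaurentSeries ℂ) (n : ℤ) :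
    (f ^ n).order = n * f.order := by
  have hinv : ∀ g : LaurentSeries ℂ, (g⁻¹).order = -g.order := by
    intro g
    rcases eq_or_ne g 0 with rfl | hg
    · simp
    · have := HahnSeries.order_mul hg (inv_ne_zero hg)
      rw [mul_inv_cancel₀ hg, HahnSeries.order_one] at this
      linarith
  rcases n with n | n
  · simp [HahnSeries.order_pow]
  · rw [zpow_negSucc, hinv, HahnSeries.order_pow, Int.negSucc_eq]
    simp; ring

theorem sqSeries_coeff_of_lt {p n i : ℤ} (hi : i < n) : (sqSeries p n).coeff i = 0 := by
  refine LaurentSeries.coeff_mul_eq_zero_of_lt (a := n) (b := 0)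
    (fun j hj => HahnSeries.coeff_eq_zero_of_lt_order ?_)
    (fun j hj => HahnSeries.coeff_eq_zero_of_lt_order ?_) (by simpa using hi)
  · simpa [LaurentSeries.order_zpow, laurentLog_order] using hj
  · simpa [LaurentSeries.order_zpow, laurentOneAdd_order] using hj

theorem laurentDerivation_sqSeries (p n : ℤ) :
    laurentDerivation (sqSeries (p + 1) (n + 1)) =
      ((n : ℂ) + 1) • sqSeries p n + (p : ℂ) • sqSeries p (n + 1) := by
  rw [sqSeries, Derivation.leibniz, laurentDerivation_oneAdd_zpow, Derivation.leibniz_zpow,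
    laurentDerivation_log]
  simp only [sqSeries, ← Int.cast_smul_eq_zsmul ℂ, smul_eq_mul, add_sub_cancel_right]
  rw [zpow_sub₀ laurentOneAdd_ne_zero, zpow_one]
  push_cast
  simp only [mul_smul_comm, div_eq_mul_inv]
  rw [add_comm]
  congr 2
  ring

/-- The series `(1+z) log(1+z)`, for which `L[0] = Res_z Y(ω,z) (1+z) log(1+z)`. -/
theorem sqSeries_two_one : sqSeries 2 1 = laurentLog * laurentOneAdd := by
  simp [sqSeries]

theorem laurentDerivation_sqSeries_two_one :
    laurentDerivation (sqSeries 2 1) = 1 + laurentLog := by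
  rw [sqSeries_two_one, Derivation.leibniz, laurentDerivation_oneAdd, laurentDerivation_log]
  simp [mul_inv_cancel₀ laurentOneAdd_ne_zero, add_comm]

theorem laurentOneAdd_zpow_neg_coeff_zero (l : ℕ) :
    (laurentOneAdd ^ (-(l : ℤ))).coeff 0 = 1 := by
  have : laurentOneAdd ^ (-(l : ℤ)) =
      ((((1 + PowerSeries.X : PowerSeries ℂ)⁻¹) ^ l : PowerSeries ℂ) : LaurentSeries ℂ) := by
    rw [zpow_neg, zpow_natCast, ← inv_pow, laurentOneAdd_inv]
    simp
  rw [this, PowerSeries.coeff_coe, if_neg (by simp), Int.natAbs_zero,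
    PowerSeries.coeff_zero_eq_constantCoeff_apply, map_pow, PowerSeries.constantCoeff_inv]
  simp

/-- The second derivative of $(1+z)\log(1+z)$ is $(1+z)^{-1}$, so from then on all derivatives are
multiples of powers of $1+z$. The multiple is read off at $z=0$. No logarithm survives, so in the
commutator with $L[0]$ the higher terms are again square bracket modes with the same index `n`. -/
theorem hasseDeriv_sqSeries_two_one (l : ℕ) :
    LaurentSeries.hasseDeriv ℂ (l + 2) (sqSeries 2 1) =
      (sqSeries 2 1).coeff (l + 2) • laurentOneAdd ^ (-1 - (l : ℤ)) := by
  have step : ∀ j : ℕ, laurentDerivation (LaurentSeries.hasseDeriv ℂ j (sqSeries 2 1)) =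
      ((j : ℂ) + 1) • LaurentSeries.hasseDeriv ℂ (j + 1) (sqSeries 2 1) := by
    intro j
    rw [laurentDerivation_apply, LaurentSeries.hasseDeriv_comp, Nat.choose_one_right,
      ← Nat.cast_smul_eq_nsmul ℂ, add_comm 1 j]
    push_cast; rfl
  have h : ∃ c : ℂ, LaurentSeries.hasseDeriv ℂ (l + 2) (sqSeries 2 1) =
      c • laurentOneAdd ^ (-1 - (l : ℤ)) := by
    induction l with
    | zero =>
      have h1 := step 1
      have h0 : LaurentSeries.hasseDeriv ℂ 1 (sqSeries 2 1) = 1 + laurentLog :=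
        laurentDerivation_sqSeries_two_one
      rw [h0, map_add, laurentDerivation_log, Derivation.map_one_eq_zero, zero_add] at h1
      refine ⟨((1 : ℂ) + 1)⁻¹, ?_⟩
      rw [eq_inv_smul_iff₀ (by norm_num)]
      have : (-1 - ((0 : ℕ) : ℤ)) = -1 := by simp
      rw [this, zpow_neg_one, h1]
      simp
    | succ l ih =>
      obtain ⟨c, hc⟩ := ih
      have h1 := step (l + 2)
      rw [hc, Derivation.map_smul, laurentDerivation_oneAdd_zpow] at h1
      have hne : (((l + 2 : ℕ) : ℂ) + 1) ≠ 0 := Nat.cast_add_one_ne_zero _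
      refine ⟨(((l + 2 : ℕ) : ℂ) + 1)⁻¹ * (c * ((-1 - (l : ℤ) : ℤ) : ℂ)), ?_⟩
      rw [mul_smul, eq_inv_smul_iff₀ hne, mul_smul]
      have e : (-1 - ((l + 1 : ℕ) : ℤ)) = -1 - (l : ℤ) - 1 := by push_cast; ring
      rw [e, h1]
  obtain ⟨c, hc⟩ := h
  have h0 := congrArg (fun f : LaurentSeries ℂ => f.coeff 0) hc
  have e : (-1 - (l : ℤ)) = -((l + 1 : ℕ) : ℤ) := by push_cast; ring
  simp only [LaurentSeries.hasseDeriv_coeff, HahnSeries.coeff_smul, e,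
    laurentOneAdd_zpow_neg_coeff_zero, smul_eq_mul, mul_one, zero_add] at h0
  rw [Ring.choose_natCast, Nat.choose_self] at h0
  rw [hc, ← h0]
  simp

theorem sqSeries_two_one_coeff_zero : (sqSeries 2 1).coeff 0 = 0 :=
  sqSeries_coeff_of_lt one_pos

theorem sqSeries_two_one_coeff_one : (sqSeries 2 1).coeff 1 = 1 := by
  have := congrArg (fun f : LaurentSeries ℂ => f.coeff 0) laurentDerivation_sqSeries_two_one
  simpa [laurentDerivation_apply, laurentLog_coeff_of_lt] using this

theorem sqSeries_two_one_coeff_three : (sqSeries 2 1).coeff 3 = -1 / 6 := by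
  have := congrArg (fun f : LaurentSeries ℂ => f.coeff 2) laurentDerivation_sqSeries_two_one
  simp [laurentDerivation_apply, laurentLog, PowerSeries.coeff_coe, HahnSeries.coeff_one] at this
  have h3 : (3 : ℂ) * (sqSeries 2 1).coeff 3 = -1 / 2 := by
    rw [this]; norm_num
  linear_combination h3 / 3

/-! ### The adjoint module and the weight projections. -/

namespace VertexOperatorAlgebra

variable {V : Type*} [AddCommGroup V] [Module ℂ V]

/-- A vertex operator algebra as a module over itself. -/
def adjoint (A : VertexOperatorAlgebra V) : VOAModule A V where
  mode := A.mode
  lowestWeight := (A.bounded_below.choose : ℂ)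
  truncation := A.truncation
  vac_mode := A.vac_mode
  jacobi := A.jacobi
  virasoro := A.virasoro
  translation := A.translation
  isInternal := by
    obtain hN := A.bounded_below.choose_spec
    set N := A.bounded_below.choose
    rw [DirectSum.isInternal_submodule_iff_iSupIndep_and_iSup_eq_top]
    constructor
    · refine (Module.End.eigenspaces_iSupIndep (A.mode 1 A.conf)).comp
        (f := fun n : ℕ => (N : ℂ) + n) fun a b h => ?_
      simpa using h
    · rw [eq_top_iff, ← A.isInternal.submodule_iSup_eq_top]
      refine iSup_le fun n => ?_
      rcases lt_or_ge n N with h | h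
      · rw [hN n h]; exact bot_le
      · obtain ⟨k, rfl⟩ := Int.le.dest h
        refine le_trans (le_of_eq ?_)
          (le_iSup (fun n : ℕ => Module.End.eigenspace (A.mode 1 A.conf) ((N : ℂ) + n)) k)
        push_cast; rfl
  finiteDimensional n := by
    have := A.finiteDimensional (A.bounded_below.choose + n)
    rwa [Int.cast_add, Int.cast_natCast] at this

theorem proj_of_mem (A : VertexOperatorAlgebra V) {p q : ℤ} {v : V}
    (hv : A.mode 1 A.conf v = (q : ℂ) • v) : A.proj p v = if p = q then v else 0 := by
  have hv' : v ∈ Module.End.eigenspace (A.mode 1 A.conf) (q : ℂ) :=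
    Module.End.mem_eigenspace_iff.mpr hv
  let e := LinearEquiv.ofBijective (DirectSum.coeLinearMap
      fun n : ℤ => Module.End.eigenspace (A.mode 1 A.conf) (n : ℂ)) A.isInternal
  have he : e.symm v = DirectSum.lof ℂ ℤ
      (fun n : ℤ => Module.End.eigenspace (A.mode 1 A.conf) (n : ℂ)) q ⟨v, hv'⟩ := by
    rw [LinearEquiv.symm_apply_eq]
    exact (DirectSum.coeLinearMap_lof
      (fun n : ℤ => Module.End.eigenspace (A.mode 1 A.conf) (n : ℂ)) q ⟨v, hv'⟩).symm
  change ((DirectSum.component ℂ ℤ _ p (e.symm v) :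
    Module.End.eigenspace (A.mode 1 A.conf) (p : ℂ)) : V) = _
  rw [he]
  split_ifs with h
  · subst h
    rw [DirectSum.component.lof_self]
  · rw [DirectSum.component.of, dif_neg (fun h' => h h'.symm)]
    rfl

theorem proj_support_finite (A : VertexOperatorAlgebra V) (v : V) :
    (Function.support fun p => A.proj p v).Finite := by
  have hv : v ∈ ⨆ n : ℤ, Module.End.eigenspace (A.mode 1 A.conf) (n : ℂ) := by
    rw [A.isInternal.submodule_iSup_eq_top]; trivial
  induction hv using Submodule.iSup_induction' with
  | mem q x hx =>
    refine (Set.finite_singleton q).subset fun p hp => ?_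
    by_contra h
    refine hp ?_
    simp only [A.proj_of_mem (Module.End.mem_eigenspace_iff.mp hx)]
    exact if_neg h
  | zero => simp
  | add x y _ _ hx hy =>
    refine (hx.union hy).subset fun p hp => ?_
    by_contra h
    simp only [Set.mem_union, Function.mem_support, not_or, not_not] at h
    exact hp (by simp [h.1, h.2])

end VertexOperatorAlgebra

/-! ### Residues of vertex operators and their commutators. -/

namespace VOAModule

variable {V : Type*} [AddCommGroup V] [Module ℂ V] {A : VertexOperatorAlgebra V}
  {U : Type*} [AddCommGroup U] [Module ℂ U]

/-- `Res_z f(z) Y(v,z) u`, bilinear in `v` and `u`. -/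
def res (M : VOAModule A U) (f : LaurentSeries ℂ) : V →ₗ[ℂ] U →ₗ[ℂ] U :=
  LinearMap.mk₂ ℂ (fun v u => seqRes f fun i => M.mode i v u)
    (fun v w u => by
      simp only [map_add, LinearMap.add_apply]
      exact seqRes_add_right f (M.truncation v u) (M.truncation w u))
    (fun c v u => by
      simp only [map_smul, LinearMap.smul_apply]
      exact seqRes_smul_right c f (M.truncation v u))
    (fun v u w => by
      simp only [map_add]
      exact seqRes_add_right f (M.truncation v u) (M.truncation v w))
    (fun c v u => by
      simp only [map_smul]
      exact seqRes_smul_right c f (M.truncation v u))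

theorem res_apply (M : VOAModule A U) (f : LaurentSeries ℂ) (v : V) (u : U) :
    M.res f v u = seqRes f fun i => M.mode i v u := rfl

/-- `Res_z f(z) Y(v,z) u` as a linear function of the series `f`. -/
def resSeries (M : VOAModule A U) (v : V) (u : U) : LaurentSeries ℂ →ₗ[ℂ] U where
  toFun f := M.res f v u
  map_add' f g := seqRes_add_left f g (M.truncation v u)
  map_smul' c f := seqRes_smul_left c f (M.truncation v u)

theorem resSeries_apply (M : VOAModule A U) (v : V) (u : U) (f : LaurentSeries ℂ) :
    M.resSeries v u f = M.res f v u := rfl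

theorem res_single (M : VOAModule A U) (n : ℤ) (c : ℂ) (v : V) (u : U) :
    M.res (HahnSeries.single n c) v u = c • M.mode n v u := seqRes_single n c _

theorem res_eq_zero (M : VOAModule A U) {f : LaurentSeries ℂ} {v : V} {u : U} {N : ℤ}
    (hf : ∀ i, i < N → f.coeff i = 0) (hN : ∀ n, N ≤ n → M.mode n v u = 0) : M.res f v u = 0 :=
  seqRes_eq_zero hf hN

/-- The commutator formula in components. -/
theorem mode_commutator (M : VOAModule A U) (a b : V) (L : ℕ)
    (hL : ∀ l : ℕ, L ≤ l → A.mode l a b = 0) (i n : ℤ) (u : U) :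
    M.mode i a (M.mode n b u) - M.mode n b (M.mode i a u) =
      ∑ l ∈ Finset.range L, ((Ring.choose i l : ℤ) : ℂ) • M.mode (i + n - l) (A.mode l a b) u := by
  have h := M.jacobi 0 i n a b u
  -- The Jacobi identity at `l = 0`: the binomials $\binom0j$ kill every term on the right except `j
  -- = 0`.
  rw [finsum_eq_finsetSum_of_support_subset (s := Finset.range L),
    finsum_eq_single _ 0] at h
  · simpa using h.symm
  · intro j hj
    obtain ⟨k, rfl⟩ := Nat.exists_eq_succ_of_ne_zero hj
    simp [Ring.choose_zero_succ]
  · intro l hl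
    by_contra h'
    refine hl ?_
    simp only [Finset.coe_range, Set.mem_Iio, not_lt] at h'
    simp [hL l h']

/-- The commutator formula for residues against Laurent series. -/
theorem res_commutator (M : VOAModule A U) (f g : LaurentSeries ℂ) (a b : V) (L : ℕ)
    (hL : ∀ l : ℕ, L ≤ l → A.mode l a b = 0) (u : U) :
    M.res f a (M.res g b u) - M.res g b (M.res f a u) =
      ∑ l ∈ Finset.range L, M.res (LaurentSeries.hasseDeriv ℂ l f * g) (A.mode l a b) u := by
  have hcoeff : ∀ (f : LaurentSeries ℂ) (N : ℤ), (∀ i, i < N → f.coeff i = 0) →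
      ∀ l ∈ Finset.range L, ∀ i, i < N - L → (LaurentSeries.hasseDeriv ℂ l f).coeff i = 0 := by
    intro f N hf l hl i hi
    have := Finset.mem_range.mp hl
    rw [LaurentSeries.hasseDeriv_coeff, hf _ (by omega), smul_zero]
  have hord : ∀ f : LaurentSeries ℂ, ∀ i, i < f.order → f.coeff i = 0 :=
    fun f i hi => HahnSeries.coeff_eq_zero_of_lt_order hi
  obtain ⟨K, hK⟩ : ∃ K : ℤ, ∀ l ∈ Finset.range L, ∀ n, K ≤ n → M.mode n (A.mode l a b) u = 0 := by
    choose T hT using fun l : ℕ => M.truncation (A.mode l a b) u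
    obtain ⟨K, hK⟩ := ((Finset.range L).image T).exists_le
    exact ⟨K, fun l hl n hn => hT l n ((hK _ (Finset.mem_image_of_mem T hl)).trans hn)⟩
  -- Extension from modes to series takes two rounds: first `g` is a monomial and `f` arbitrary,
  -- then `f` is fixed and `g` arbitrary. The common truncation bound `K` makes both sides vanish
  -- for series of high order.
  have mono : ∀ (n : ℤ) (f : LaurentSeries ℂ),
      M.res f a (M.mode n b u) - M.mode n b (M.res f a u) =
      ∑ l ∈ Finset.range L, M.res (LaurentSeries.hasseDeriv ℂ l f * HahnSeries.single n 1)
        (A.mode l a b) u := by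
    intro n f
    let Ψ : LaurentSeries ℂ →ₗ[ℂ] U :=
      M.resSeries a (M.mode n b u) - M.mode n b ∘ₗ M.resSeries a u
        - ∑ l ∈ Finset.range L, M.resSeries (A.mode l a b) u ∘ₗ
            LinearMap.mulRight ℂ (HahnSeries.single n 1) ∘ₗ LaurentSeries.hasseDeriv ℂ l
    have key : Ψ f = 0 := by
      obtain ⟨N₁, h₁⟩ := M.truncation a (M.mode n b u)
      obtain ⟨N₂, h₂⟩ := M.truncation a u
      refine laurentFunctional_eq_zero Ψ
        ⟨max (max N₁ N₂) (K + L - n), fun f hf => ?_⟩ (fun i => ?_) f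
      · have e1 : M.res f a (M.mode n b u) = 0 := M.res_eq_zero hf fun i hi =>
          h₁ i ((le_max_left _ _).trans ((le_max_left _ _).trans hi))
        have e2 : M.res f a u = 0 := M.res_eq_zero hf fun i hi =>
          h₂ i ((le_max_right _ _).trans ((le_max_left _ _).trans hi))
        have e3 : ∀ l ∈ Finset.range L, M.res (LaurentSeries.hasseDeriv ℂ l f *
            HahnSeries.single n 1) (A.mode l a b) u = 0 := by
          intro l hl
          refine M.res_eq_zero (fun i hi => ?_) (hK l hl)
          rw [HahnSeries.coeff_mul_single,
            hcoeff f (K + L - n) (fun i hi => hf i (lt_max_of_lt_right hi)) l hl _ (by linarith),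
            zero_mul]
        simp only [Ψ, LinearMap.sub_apply, LinearMap.comp_apply, resSeries_apply,
          LinearMap.sum_apply, LinearMap.mulRight_apply, e1, e2, Finset.sum_eq_zero e3, map_zero,
          sub_zero]
      · simp only [Ψ, LinearMap.sub_apply, LinearMap.comp_apply, resSeries_apply,
          LinearMap.sum_apply, LinearMap.mulRight_apply, res_single, one_smul,
          M.mode_commutator a b L hL, LaurentSeries.hasseDeriv_single, HahnSeries.single_mul_single]
        refine sub_eq_zero.mpr (Finset.sum_congr rfl fun l _ => ?_)
        rw [show i - (l : ℤ) + n = i + n - l by ring]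
        simp
    simpa only [Ψ, LinearMap.sub_apply, LinearMap.comp_apply, resSeries_apply,
      LinearMap.sum_apply, LinearMap.mulRight_apply, sub_eq_zero] using key
  let Φ : LaurentSeries ℂ →ₗ[ℂ] U :=
    M.res f a ∘ₗ M.resSeries b u - M.resSeries b (M.res f a u)
      - ∑ l ∈ Finset.range L, M.resSeries (A.mode l a b) u ∘ₗ
          LinearMap.mulLeft ℂ (LaurentSeries.hasseDeriv ℂ l f)
  have key : Φ g = 0 := by
    obtain ⟨N₁, h₁⟩ := M.truncation b u
    obtain ⟨N₂, h₂⟩ := M.truncation b (M.res f a u)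
    refine laurentFunctional_eq_zero Φ
      ⟨max (max N₁ N₂) (K + L - f.order), fun g hg => ?_⟩ (fun n => ?_) g
    · have e1 : M.res g b u = 0 := M.res_eq_zero hg fun i hi =>
        h₁ i ((le_max_left _ _).trans ((le_max_left _ _).trans hi))
      have e2 : M.res g b (M.res f a u) = 0 := M.res_eq_zero hg fun i hi =>
        h₂ i ((le_max_right _ _).trans ((le_max_left _ _).trans hi))
      have e3 : ∀ l ∈ Finset.range L, M.res (LaurentSeries.hasseDeriv ℂ l f * g)
          (A.mode l a b) u = 0 := by
        intro l hl
        refine M.res_eq_zero (fun i hi => ?_) (hK l hl)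
        exact LaurentSeries.coeff_mul_eq_zero_of_lt (hcoeff f f.order (hord f) l hl)
          (fun j hj => hg j (lt_max_of_lt_right hj))
          (lt_of_lt_of_eq hi (show K = (f.order - L) + (K + L - f.order) by ring))
      simp only [Φ, LinearMap.sub_apply, LinearMap.comp_apply, resSeries_apply,
        LinearMap.sum_apply, LinearMap.mulLeft_apply, e1, e2, Finset.sum_eq_zero e3, map_zero,
        sub_zero]
    · simp only [Φ, LinearMap.sub_apply, LinearMap.comp_apply, resSeries_apply,
        LinearMap.sum_apply, LinearMap.mulLeft_apply, res_single, one_smul, mono n f, sub_self]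
  simpa only [Φ, LinearMap.sub_apply, LinearMap.comp_apply, resSeries_apply,
    LinearMap.sum_apply, LinearMap.mulLeft_apply, sub_eq_zero] using key

/-- The translation property for residues against Laurent series. -/
theorem res_translation (M : VOAModule A U) (f : LaurentSeries ℂ) (v : V) (u : U) :
    M.res f (A.mode 0 A.conf v) u = -M.res (laurentDerivation f) v u := by
  simp only [res_apply, seqRes, M.translation]
  rw [← finsum_neg_distrib, ← finsum_comp_equiv (Equiv.addRight (1 : ℤ))]
  refine finsum_congr fun i => ?_
  simp only [Equiv.coe_addRight, add_sub_cancel_right, laurentDerivation_apply,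
    LaurentSeries.hasseDeriv_coeff, Ring.choose_one_right, smul_smul, zsmul_eq_mul]
  rw [← neg_smul]
  congr 1
  push_cast; ring

/-! ### Square bracket modes -/

/-- The modes `v[n]` as bilinear maps. -/
def sqModeₗ (M : VOAModule A U) (n : ℤ) : V →ₗ[ℂ] U →ₗ[ℂ] U :=
  LinearMap.mk₂ ℂ (fun v u => ∑ᶠ p : ℤ, M.res (sqSeries p n) (A.proj p v) u)
    (fun v w u => by
      rw [← finsum_add_distrib]
      · simp
      · exact (A.proj_support_finite v).subset fun p hp h => hp (by simp [h])
      · exact (A.proj_support_finite w).subset fun p hp h => hp (by simp [h]))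
    (fun c v u => by
      rw [smul_finsum']
      · simp
      · exact (A.proj_support_finite v).subset fun p hp h => hp (by simp [h]))
    (fun v u w => by
      rw [← finsum_add_distrib]
      · simp
      · exact (A.proj_support_finite v).subset fun p hp h => hp (by simp [h])
      · exact (A.proj_support_finite v).subset fun p hp h => hp (by simp [h]))
    (fun c v u => by
      rw [smul_finsum']
      · simp
      · exact (A.proj_support_finite v).subset fun p hp h => hp (by simp [h]))

theorem sqMode_eq (M : VOAModule A U) (v : V) (n : ℤ) (u : U) :
    M.sqMode v n u = M.sqModeₗ n v u := rfl

theorem sqModeₗ_of_weight (M : VOAModule A U) (n : ℤ) {p : ℤ} {v : V}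
    (hv : A.mode 1 A.conf v = (p : ℂ) • v) (u : U) :
    M.sqModeₗ n v u = M.res (sqSeries p n) v u := by
  change ∑ᶠ q : ℤ, M.res (sqSeries q n) (A.proj q v) u = _
  rw [finsum_eq_single _ p]
  · rw [A.proj_of_mem hv, if_pos rfl]
  · intro q hq
    rw [A.proj_of_mem hv, if_neg hq]
    simp

theorem res_vac (M : VOAModule A U) (f : LaurentSeries ℂ) (u : U) :
    M.res f A.vac u = f.coeff (-1) • u := by
  rw [res_apply, seqRes, finsum_eq_single _ (-1)]
  · simp [M.vac_mode]
  · intro i hi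
    simp [M.vac_mode, hi]

theorem sqModeₗ_vac (M : VOAModule A U) (u : U) {n : ℤ} (hn : 0 ≤ n) :
    M.sqModeₗ n A.vac u = 0 := by
  rw [M.sqModeₗ_of_weight n (p := 0) (by simp [A.vac_weight]), res_vac,
    sqSeries_coeff_of_lt (by omega), zero_smul]

/-- The operator `L[0] = ∑ a_i ω(i)`, where `(1+z) log(1+z) = ∑ a_i z^i`. -/
def sqLZero (M : VOAModule A U) : U →ₗ[ℂ] U := M.res (sqSeries 2 1) A.conf

theorem sqL_eq (M : VOAModule A U) (n : ℤ) (u : U) :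
    M.sqL n u = M.sqModeₗ (n + 1) A.confTilde u := rfl

theorem sqL_zero (M : VOAModule A U) (u : U) : M.sqL 0 u = M.sqLZero u := by
  rw [sqL_eq, VertexOperatorAlgebra.confTilde, map_sub, LinearMap.sub_apply, map_smul,
    LinearMap.smul_apply, M.sqModeₗ_vac u (by norm_num), smul_zero, sub_zero,
    M.sqModeₗ_of_weight _ (p := 2) (by simp [A.conf_weight])]
  rfl

theorem mem_sqWeight (M : VOAModule A U) {k : ℂ} {u : U} :
    u ∈ M.sqWeight k ↔ u ∈ Module.End.eigenspace M.sqLZero k := by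
  rw [Module.End.mem_eigenspace_iff, ← sqL_zero]; rfl

/-- `L(n)` lowers the weight by `n`. -/
theorem weight_mode_conf (M : VOAModule A U) {c : ℂ} {u : U}
    (hu : M.mode 1 A.conf u = c • u) (i : ℕ) :
    M.mode 1 A.conf (M.mode i A.conf u) = (c - i + 1) • M.mode i A.conf u := by
  have h := M.virasoro 0 ((i : ℤ) - 1) u
  simp only [zero_add, sub_add_cancel, hu, map_smul] at h
  have h0 : (if (i : ℤ) - 1 = 0 then (((0 : ℤ) : ℂ) ^ 3 - ((0 : ℤ) : ℂ)) / 12 * A.centralCharge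
      else 0) = 0 := by simp
  rw [h0, zero_smul, add_zero, sub_eq_iff_eq_add, ← add_smul] at h
  rw [h]
  congr 1
  push_cast; ring

/-- `L[0] v` in the vertex operator algebra, as a finite sum. -/
theorem sqLZero_eq_sum (M : VOAModule A U) (u : U) (L : ℕ)
    (hL : ∀ l : ℕ, L ≤ l → M.mode l A.conf u = 0) :
    M.sqLZero u = ∑ l ∈ Finset.range L, (sqSeries 2 1).coeff l • M.mode l A.conf u := by
  rw [sqLZero, res_apply, seqRes,
    finsum_eq_finsetSum_of_support_subset (s := (Finset.range L).map Nat.castEmbedding)]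
  · simp
  · intro i hi
    simp only [Finset.coe_map, Set.mem_image, Finset.coe_range, Set.mem_Iio]
    rcases lt_or_ge i 0 with h | h
    · exact absurd (by simp [sqSeries_coeff_of_lt (show i < 1 by omega)]) hi
    · obtain ⟨l, rfl⟩ := Int.eq_ofNat_of_zero_le h
      refine ⟨l, ?_, rfl⟩
      by_contra h'
      exact hi (by simp [hL l (not_lt.mp h')])

/-- `[L[0], v[n]] = (L[0]v)[n] - (n+1) v[n]`, for `v` homogeneous. -/
theorem sqLZero_commutator_of_weight (M : VOAModule A U) (n : ℤ) {p : ℤ} {v : V}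
    (hv : A.mode 1 A.conf v = (p : ℂ) • v) (u : U) :
    M.sqLZero (M.sqModeₗ n v u) - M.sqModeₗ n v (M.sqLZero u) =
      M.sqModeₗ n (A.adjoint.sqLZero v) u - ((n : ℂ) + 1) • M.sqModeₗ n v u := by
  obtain ⟨N, hN⟩ := A.truncation A.conf v
  -- The added 2 guarantees that the terms `l = 0` and `l = 1` can be split off.
  have hL : ∀ l : ℕ, N.toNat + 2 ≤ l → A.mode l A.conf v = 0 := fun l hl => hN l (by omega)
  have hw : ∀ l : ℕ, A.mode 1 A.conf (A.mode l A.conf v) =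
      ((p - l + 1 : ℤ) : ℂ) • A.mode l A.conf v := by
    intro l
    have := A.adjoint.weight_mode_conf (u := v) (c := p) hv l
    push_cast
    exact this
  rw [A.adjoint.sqLZero_eq_sum v _ hL, sqLZero, M.sqModeₗ_of_weight n hv,
    M.sqModeₗ_of_weight n hv, M.res_commutator _ _ A.conf v _ hL, Finset.sum_range_succ',
    Finset.sum_range_succ', Finset.sum_range_succ', Finset.sum_range_succ']
  -- The term `l = 0` is a total derivative and `l = 1` is a multiple of `v`; their
  -- $(\log(1+z))^{n+1}$ contributions cancel, leaving $p\,v[n]-(n+1)v[n]$. The terms `l ≥ 2`,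
  -- together with $p\,v[n]$, are $(L[0]v)[n]$: the vector $\omega(l)v$ has weight $p-l+1$, which
  -- matches the power of $1+z$.
  have e0 : M.res (LaurentSeries.hasseDeriv ℂ 0 (sqSeries 2 1) * sqSeries p n)
      (A.mode (0 : ℕ) A.conf v) u =
      -(((n : ℂ) + 1) • M.res (sqSeries p n) v u + (p : ℂ) • M.res (sqSeries p (n + 1)) v u) := by
    have hs : LaurentSeries.hasseDeriv ℂ 0 (sqSeries 2 1) * sqSeries p n =
        sqSeries (p + 1) (n + 1) := by
      rw [LaurentSeries.hasseDeriv_zero, LinearMap.id_apply, sqSeries_two_one, sqSeries, sqSeries,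
        zpow_add_one₀ laurentLog_ne_zero, add_sub_cancel_right,
        zpow_sub_one₀ laurentOneAdd_ne_zero]
      field_simp [laurentOneAdd_ne_zero]
    rw [hs, Nat.cast_zero, M.res_translation, laurentDerivation_sqSeries, ← resSeries_apply,
      map_add, map_smul, map_smul]
    rfl
  have e1 : M.res (LaurentSeries.hasseDeriv ℂ (0 + 1) (sqSeries 2 1) * sqSeries p n)
      (A.mode ((0 + 1 : ℕ) : ℤ) A.conf v) u =
      (p : ℂ) • M.res (sqSeries p n) v u + (p : ℂ) • M.res (sqSeries p (n + 1)) v u := by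
    have hs : LaurentSeries.hasseDeriv ℂ (0 + 1) (sqSeries 2 1) * sqSeries p n =
        sqSeries p n + sqSeries p (n + 1) := by
      rw [zero_add, ← laurentDerivation_apply, laurentDerivation_sqSeries_two_one, sqSeries,
        sqSeries, zpow_add_one₀ laurentLog_ne_zero]
      ring
    rw [hs, zero_add, Nat.cast_one, hv, map_smul, LinearMap.smul_apply, ← smul_add,
      ← resSeries_apply, map_add]
    rfl
  have e2 : ∀ l : ℕ, M.res (LaurentSeries.hasseDeriv ℂ (l + 1 + 1) (sqSeries 2 1) * sqSeries p n)
      (A.mode ((l + 1 + 1 : ℕ) : ℤ) A.conf v) u =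
      M.sqModeₗ n ((sqSeries 2 1).coeff ((l + 1 + 1 : ℕ) : ℤ) •
        A.adjoint.mode ((l + 1 + 1 : ℕ) : ℤ) A.conf v) u := by
    intro l
    have hs : LaurentSeries.hasseDeriv ℂ (l + 1 + 1) (sqSeries 2 1) * sqSeries p n =
        (sqSeries 2 1).coeff ((l + 1 + 1 : ℕ) : ℤ) • sqSeries (p - (l + 1 + 1 : ℕ) + 1) n := by
      rw [hasseDeriv_sqSeries_two_one, smul_mul_assoc]
      congr 1
      rw [sqSeries, sqSeries, mul_left_comm, ← zpow_add₀ laurentOneAdd_ne_zero]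
      congr 2
      push_cast; ring
    rw [hs, map_smul, LinearMap.smul_apply, ← resSeries_apply, map_smul, resSeries_apply]
    congr 1
    exact (M.sqModeₗ_of_weight n (hw _) u).symm
  rw [e0, e1, Finset.sum_congr rfl fun l _ => e2 l]
  simp only [zero_add, Nat.cast_zero, Nat.cast_one, sqSeries_two_one_coeff_zero, zero_smul,
    sqSeries_two_one_coeff_one, one_smul, add_zero, map_add, map_sum, LinearMap.add_apply,
    LinearMap.sum_apply]
  have e3 : A.adjoint.mode 1 A.conf v = (p : ℂ) • v := hv
  rw [e3, map_smul, LinearMap.smul_apply, M.sqModeₗ_of_weight n hv]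
  abel

/-- `[L[0], v[n]] = (L[0]v)[n] - (n+1) v[n]`. -/
theorem sqLZero_commutator (M : VOAModule A U) (n : ℤ) (v : V) (u : U) :
    M.sqLZero (M.sqModeₗ n v u) - M.sqModeₗ n v (M.sqLZero u) =
      M.sqModeₗ n (A.adjoint.sqLZero v) u - ((n : ℂ) + 1) • M.sqModeₗ n v u := by
  have hv : v ∈ ⨆ n : ℤ, Module.End.eigenspace (A.mode 1 A.conf) (n : ℂ) := by
    rw [A.isInternal.submodule_iSup_eq_top]; trivial
  induction hv using Submodule.iSup_induction' with
  | mem q x hx =>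
    exact M.sqLZero_commutator_of_weight n (Module.End.mem_eigenspace_iff.mp hx) u
  | zero => simp
  | add x y _ _ hx hy =>
    simp only [map_add, LinearMap.add_apply, smul_add]
    rw [add_sub_add_comm, hx, hy]
    abel

/-- `v[n]` maps `U_[k]` to `U_[k+h-n-1]` if `L[0] v = h v`. -/
theorem sqMode_mem_sqWeight (M : VOAModule A U) (n : ℤ) {h k : ℂ} {v : V} {u : U}
    (hv : A.adjoint.sqLZero v = h • v) (hu : u ∈ M.sqWeight k) :
    M.sqMode v n u ∈ M.sqWeight (k + h - n - 1) := by
  rw [mem_sqWeight, Module.End.mem_eigenspace_iff] at hu ⊢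
  have := M.sqLZero_commutator n v u
  rw [hu, hv, map_smul, map_smul, LinearMap.smul_apply, ← sub_smul, sub_eq_iff_eq_add,
    ← add_smul] at this
  rw [sqMode_eq, this]
  congr 1
  ring

/-- `L[0] ω̃ = 2 ω̃`. -/
theorem sqLZero_confTilde (A : VertexOperatorAlgebra V) :
    A.adjoint.sqLZero A.confTilde = (2 : ℂ) • A.confTilde := by
  have hvac : A.adjoint.sqLZero A.vac = 0 := by
    rw [sqLZero, res_apply]
    exact seqRes_eq_zero (N := 0) (fun i hi => sqSeries_coeff_of_lt (by omega))
      fun i hi => A.creation_nonneg _ i hi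
  -- Write $\omega=L(-2)\mathbf 1$ and commute $L(n)$ past $L(-2)$; $L(n)$ kills the vacuum.
  have hmode : ∀ n : ℕ, A.mode (n + 1 : ℤ) A.conf A.conf =
      ((n : ℂ) + 2) • A.mode ((n : ℤ) - 1) A.conf A.vac +
        (if n = 2 then A.centralCharge / 2 else 0) • A.vac := by
    intro n
    have h := A.virasoro n (-2) A.vac
    have h1 : A.mode (-2 + 1) A.conf A.vac = A.conf := A.creation A.conf
    rw [h1, A.creation_nonneg _ _ (by positivity : (0 : ℤ) ≤ n + 1), map_zero, sub_zero] at h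
    rw [h]
    have e1 : (n : ℤ) + -2 + 1 = n - 1 := by ring
    rw [e1]
    congr 2
    · push_cast; ring
    · by_cases hn : n = 2
      · subst hn; norm_num; ring
      · rw [if_neg hn, if_neg (by omega)]
  have hL : ∀ l : ℕ, 4 ≤ l → A.mode l A.conf A.conf = 0 := by
    intro l hl
    obtain ⟨n, rfl⟩ : ∃ n : ℕ, l = n + 3 + 1 := ⟨l - 4, by omega⟩
    have := hmode (n + 3)
    rw [A.creation_nonneg _ _ (by push_cast; omega), if_neg (by omega)] at this
    simpa using this
  have h2 : A.mode (2 : ℕ) A.conf A.conf = 0 := by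
    have := hmode 1
    rw [A.creation_nonneg _ _ (by simp)] at this
    simpa using this
  have h3 : A.mode (3 : ℕ) A.conf A.conf = (A.centralCharge / 2) • A.vac := by
    have := hmode 2
    rw [A.creation_nonneg _ _ (by simp)] at this
    simpa using this
  rw [VertexOperatorAlgebra.confTilde, map_sub, map_smul, hvac, smul_zero, sub_zero,
    A.adjoint.sqLZero_eq_sum A.conf 4 hL]
  change ∑ l ∈ Finset.range 4, (sqSeries 2 1).coeff l • A.mode l A.conf A.conf = _
  rw [Finset.sum_range_succ, Finset.sum_range_succ, Finset.sum_range_succ, Finset.sum_range_one,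
    h2, h3, Nat.cast_zero, Nat.cast_one, sqSeries_two_one_coeff_zero, sqSeries_two_one_coeff_one,
    A.conf_weight, show ((3 : ℕ) : ℤ) = 3 from rfl, sqSeries_two_one_coeff_three]
  -- What remains is $2\omega-\frac16\cdot\frac c2\mathbf 1=2(\omega-\frac c{24}\mathbf 1)$.
  simp only [smul_zero, zero_smul, smul_sub, smul_smul]
  rw [zero_add, add_zero, sub_eq_add_neg, ← neg_smul]
  congr 2 <;> ring

/-- `L[n]` maps `U_[k]` to `U_[k-n]`. -/
theorem sqL_mem_sqWeight (M : VOAModule A U) (n : ℤ) {k : ℂ} {u : U} (hu : u ∈ M.sqWeight k) :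
    M.sqL n u ∈ M.sqWeight (k - n) := by
  have := M.sqMode_mem_sqWeight (n + 1) (sqLZero_confTilde A) hu
  rwa [show k + 2 - ((n + 1 : ℤ) : ℂ) - 1 = k - n by push_cast; ring] at this

theorem sqMode_truncation (M : VOAModule A U) (v : V) (u : U) :
    ∃ N : ℤ, ∀ n, N ≤ n → M.sqMode v n u = 0 := by
  have hv : v ∈ ⨆ n : ℤ, Module.End.eigenspace (A.mode 1 A.conf) (n : ℂ) := by
    rw [A.isInternal.submodule_iSup_eq_top]; trivial
  simp only [sqMode_eq]
  induction hv using Submodule.iSup_induction' with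
  | mem q x hx =>
    obtain ⟨N, hN⟩ := M.truncation x u
    refine ⟨N, fun n hn => ?_⟩
    rw [M.sqModeₗ_of_weight n (Module.End.mem_eigenspace_iff.mp hx)]
    exact M.res_eq_zero (fun i hi => sqSeries_coeff_of_lt (hi.trans_le hn)) hN
  | zero => simp
  | add x y _ _ hx hy =>
    obtain ⟨N, hN⟩ := hx
    obtain ⟨K, hK⟩ := hy
    refine ⟨max N K, fun n hn => ?_⟩
    rw [map_add, LinearMap.add_apply, hN n ((le_max_left _ _).trans hn),
      hK n ((le_max_right _ _).trans hn), add_zero]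

/-! ### Diagonalization of `L[0]` -/

end VOAModule

/-- If `W` is spanned by the eigenspaces of `S` for the eigenvalues in a set, then every other
eigenspace of `S` is trivial. -/
theorem Module.End.eq_zero_of_iSup_eigenspace_eq_top {W ι : Type*} [AddCommGroup W] [Module ℂ W]
    {S : Module.End ℂ W} {μ : ι → ℂ} (htop : ⨆ i, S.eigenspace (μ i) = ⊤) {k : ℂ}
    (hk : ∀ i, k ≠ μ i) {w : W} (hw : w ∈ S.eigenspace k) : w = 0 := by
  have hdis := (Module.End.eigenspaces_iSupIndep S) k
  refine Submodule.disjoint_def.mp hdis w hw ?_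
  have : (⊤ : Submodule ℂ W) ≤ ⨆ j, ⨆ (_ : j ≠ k), S.eigenspace j := by
    rw [← htop]
    exact iSup_le fun i => le_iSup₂_of_le (μ i) (hk i).symm le_rfl
  exact this trivial

/-- An operator that is unitriangular with respect to the eigenspaces of eigenvalues `r + n` of
`S` is diagonalizable with the same eigenvalues. -/
theorem Module.End.iSup_eigenspace_eq_top_of_triangular {W : Type*} [AddCommGroup W] [Module ℂ W]
    {S D : Module.End ℂ W} {r : ℂ} (htop : ⨆ n : ℕ, S.eigenspace (r + n) = ⊤)
    (htri : ∀ (n : ℕ), ∀ w ∈ S.eigenspace (r + n),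
      D w - (r + n) • w ∈ ⨆ j : Fin n, S.eigenspace (r + (j : ℕ))) :
    ⨆ n : ℕ, D.eigenspace (r + n) = ⊤ := by
  have key : ∀ n : ℕ, S.eigenspace (r + n) ≤ ⨆ j : Fin (n + 1), D.eigenspace (r + (j : ℕ)) := by
    intro n
    induction n using Nat.strong_induction_on with
    | _ n ih =>
      intro w hw
      have h1 : D w - (r + n) • w ∈ ⨆ j : Fin n, D.eigenspace (r + (j : ℕ)) := by
        refine (iSup_le fun j : Fin n => (ih j j.2).trans (iSup_le fun i => ?_)) (htri n w hw)
        exact le_iSup (fun j : Fin n => D.eigenspace (r + (j : ℕ))) ⟨i, by omega⟩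
      -- On the span of the lower eigenspaces of `D` the operator $D-(r+n)$ is invertible, its
      -- eigenvalues there being $j-n\ne0$. Subtracting the solution `w'` turns `w` into an
      -- eigenvector.
      obtain ⟨w', hw', hDw'⟩ : ∃ w' ∈ ⨆ j : Fin n, D.eigenspace (r + (j : ℕ)),
          D w' - (r + n) • w' = D w - (r + n) • w := by
        generalize D w - (r + n) • w = x at h1
        induction h1 using Submodule.iSup_induction' with
        | mem j x hx =>
          have hne : ((j : ℕ) : ℂ) - n ≠ 0 := by
            rw [sub_ne_zero]
            exact_mod_cast j.2.ne
          refine ⟨(((j : ℕ) : ℂ) - n)⁻¹ • x,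
            Submodule.smul_mem _ _ (Submodule.mem_iSup_of_mem j hx), ?_⟩
          rw [map_smul, Module.End.mem_eigenspace_iff.mp hx, smul_comm, ← sub_smul,
            add_sub_add_left_eq_sub, smul_smul, mul_inv_cancel₀ hne, one_smul]
        | zero => exact ⟨0, Submodule.zero_mem _, by simp⟩
        | add x y _ _ hx hy =>
          obtain ⟨a, ha, ha'⟩ := hx
          obtain ⟨b, hb, hb'⟩ := hy
          refine ⟨a + b, Submodule.add_mem _ ha hb, ?_⟩
          rw [← ha', ← hb', map_add, smul_add]
          abel
      have h2 : w - w' ∈ D.eigenspace (r + n) := by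
        rw [Module.End.mem_eigenspace_iff, map_sub, smul_sub]
        rw [sub_eq_sub_iff_sub_eq_sub] at hDw'
        rw [sub_eq_sub_iff_sub_eq_sub, ← sub_eq_sub_iff_sub_eq_sub]
        rw [← neg_inj, neg_sub, neg_sub]
        exact hDw'
      rw [← sub_add_cancel w w']
      refine Submodule.add_mem _ ?_ ?_
      · exact Submodule.mem_iSup_of_mem (Fin.last n) (by simpa using h2)
      · refine (iSup_le fun j : Fin n => ?_ :
          ⨆ j : Fin n, D.eigenspace (r + (j : ℕ)) ≤ _) hw'
        exact le_iSup (fun j : Fin (n + 1) => D.eigenspace (r + (j : ℕ))) j.castSucc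
  rw [eq_top_iff, ← htop]
  refine iSup_le fun n => (key n).trans (iSup_le fun j => ?_)
  exact le_iSup (fun n : ℕ => D.eigenspace (r + n)) j

namespace VOAModule

variable {V : Type*} [AddCommGroup V] [Module ℂ V] {A : VertexOperatorAlgebra V}
  {U : Type*} [AddCommGroup U] [Module ℂ U]

/-- The series $(1+z)\log(1+z)=z+\dots$ gives $L[0]=L(0)+\sum_{l\ge1}a_{l+1}L(l)$, and $L(l)$ lowers
the $L(0)$-weight by $l$, so $L[0]$ is triangular with the eigenvalues of $L(0)$ on the diagonal. -/
theorem iSup_eigenspace_sqLZero (M : VOAModule A U) :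
    ⨆ n : ℕ, Module.End.eigenspace M.sqLZero (M.lowestWeight + n) = ⊤ := by
  have htop := M.isInternal.submodule_iSup_eq_top
  refine Module.End.iSup_eigenspace_eq_top_of_triangular htop fun n w hw => ?_
  have hw' := Module.End.mem_eigenspace_iff.mp hw
  obtain ⟨N, hN⟩ := M.truncation A.conf w
  have hL : ∀ l : ℕ, N.toNat + 2 ≤ l → M.mode l A.conf w = 0 := fun l hl => hN l (by omega)
  rw [M.sqLZero_eq_sum w _ hL, Finset.sum_range_succ', Finset.sum_range_succ']
  simp only [zero_add, Nat.cast_zero, Nat.cast_one, sqSeries_two_one_coeff_zero, zero_smul,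
    sqSeries_two_one_coeff_one, one_smul, add_zero, hw', add_sub_cancel_right]
  refine Submodule.sum_mem _ fun l _ => Submodule.smul_mem _ _ ?_
  have hwt := M.weight_mode_conf hw' (l + 1 + 1)
  by_cases hl : l + 1 ≤ n
  · refine Submodule.mem_iSup_of_mem ⟨n - (l + 1), by omega⟩ ?_
    rw [Module.End.mem_eigenspace_iff, hwt]
    congr 1
    push_cast [hl]
    ring
  -- Here the weight would fall below the lowest weight, so the vector is zero.
  · have : M.mode ((l + 1 + 1 : ℕ) : ℤ) A.conf w = 0 := by
      refine Module.End.eq_zero_of_iSup_eigenspace_eq_top htop (fun i h => ?_)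
        (Module.End.mem_eigenspace_iff.mpr hwt)
      have h' : ((n : ℤ) : ℂ) = ((i + (l + 1) : ℕ) : ℤ) := by
        push_cast at h ⊢
        linear_combination h
      have := Int.cast_injective h'
      omega
    rw [this]
    exact Submodule.zero_mem _

theorem isInternal_sqLZero (M : VOAModule A U) :
    DirectSum.IsInternal
      fun n : ℕ => Module.End.eigenspace M.sqLZero (M.lowestWeight + n) := by
  rw [DirectSum.isInternal_submodule_iff_iSupIndep_and_iSup_eq_top]
  refine ⟨(Module.End.eigenspaces_iSupIndep M.sqLZero).comp
    (f := fun n : ℕ => M.lowestWeight + n) fun a b h => ?_, M.iSup_eigenspace_sqLZero⟩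
  simpa using h

/-- Every weight of `U` with respect to `L[0]` lies in `r + ℕ`. -/
theorem exists_nat_of_mem_sqWeight (M : VOAModule A U) {k : ℂ} {u : U} (hu : u ∈ M.sqWeight k)
    (hne : u ≠ 0) : ∃ n : ℕ, k = M.lowestWeight + n := by
  by_contra! h
  exact hne (Module.End.eq_zero_of_iSup_eigenspace_eq_top M.iSup_eigenspace_sqLZero h
    (M.mem_sqWeight.mp hu))

end VOAModule

/-! ### The logarithm of the automorphy factor of weight one -/

/-- Holomorphic functions on the upper half-plane have primitives. -/
theorem UpperHalfPlane.exists_normalizedDeriv_eq {F : ℍ → ℂ} (hF : MDiff F) :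
    ∃ G : ℍ → ℂ, MDiff G ∧ Derivative.normalizedDerivOfComplex G = F := by
  rw [UpperHalfPlane.mdifferentiable_iff] at hF
  -- The inverse Cayley transform $w\mapsto i(1+w)/(1-w)$ carries the problem to the unit disc,
  -- where the pulled-back form $F\cdot 2i/(1-w)^2\,dw$ has a primitive.
  have hφ : ∀ w ∈ Metric.ball (0 : ℂ) 1, 1 - w ≠ 0 ∧
      Complex.I * (1 + w) / (1 - w) ∈ UpperHalfPlane.upperHalfPlaneSet := by
    intro w hw
    have hw1 : ‖w‖ < 1 := by simpa using hw
    have hne : 1 - w ≠ 0 := by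
      intro h
      rw [sub_eq_zero] at h
      simp [← h] at hw1
    refine ⟨hne, ?_⟩
    change 0 < (Complex.I * (1 + w) / (1 - w)).im
    have hn : 0 < Complex.normSq (1 - w) := Complex.normSq_pos.mpr hne
    have hw2 : Complex.normSq w < 1 := by
      rw [Complex.normSq_eq_norm_sq]
      nlinarith [norm_nonneg w]
    rw [Complex.normSq_apply] at hw2
    rw [Complex.div_im]
    have : (Complex.I * (1 + w)).im * (1 - w).re / Complex.normSq (1 - w) -
        (Complex.I * (1 + w)).re * (1 - w).im / Complex.normSq (1 - w) =
        (1 - (w.re * w.re + w.im * w.im)) / Complex.normSq (1 - w) := by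
      rw [← sub_div]
      congr 1
      simp
      ring
    rw [this]
    exact div_pos (by linarith) hn
  have hd : DifferentiableOn ℂ (fun w => (F ∘ UpperHalfPlane.ofComplex)
      (Complex.I * (1 + w) / (1 - w)) * (2 * Complex.I / (1 - w) ^ 2)) (Metric.ball 0 1) := by
    refine DifferentiableOn.mul (hF.comp ?_ fun w hw => (hφ w hw).2) ?_
    · exact DifferentiableOn.div (by fun_prop) (by fun_prop) fun w hw => (hφ w hw).1
    · exact DifferentiableOn.div (by fun_prop) (by fun_prop)
        fun w hw => pow_ne_zero 2 (hφ w hw).1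
  obtain ⟨g, hg⟩ := hd.isExactOn_ball
  have hI : ∀ τ : ℍ, (τ : ℂ) + Complex.I ≠ 0 := by
    intro τ h
    have := congrArg Complex.im h
    simp at this
    linarith [τ.im_pos]
  have hψ : ∀ τ : ℍ, ((τ : ℂ) - Complex.I) / (τ + Complex.I) ∈ Metric.ball (0 : ℂ) 1 := by
    intro τ
    rw [mem_ball_zero_iff, norm_div, div_lt_one (norm_pos_iff.mpr (hI τ))]
    refine lt_of_pow_lt_pow_left₀ 2 (norm_nonneg _) ?_
    rw [← Complex.normSq_eq_norm_sq, ← Complex.normSq_eq_norm_sq, Complex.normSq_apply,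
      Complex.normSq_apply]
    simp
    nlinarith [τ.im_pos]
  have hder : ∀ τ : ℍ, HasDerivAt (fun z : ℂ => g ((z - Complex.I) / (z + Complex.I)))
      (F τ) τ := by
    intro τ
    have h1 : HasDerivAt (fun z : ℂ => (z - Complex.I) / (z + Complex.I))
        ((1 * ((τ : ℂ) + Complex.I) - ((τ : ℂ) - Complex.I) * 1) / ((τ : ℂ) + Complex.I) ^ 2) τ :=
      ((hasDerivAt_id (τ : ℂ)).sub_const _).div ((hasDerivAt_id (τ : ℂ)).add_const _) (hI τ)
    have h2 := (hg _ (hψ τ)).comp (τ : ℂ) h1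
    have h1w : 1 - ((τ : ℂ) - Complex.I) / (τ + Complex.I) = 2 * Complex.I / (τ + Complex.I) := by
      field_simp [hI τ]; ring
    have hpt : Complex.I * (1 + ((τ : ℂ) - Complex.I) / (τ + Complex.I)) /
        (1 - ((τ : ℂ) - Complex.I) / (τ + Complex.I)) = τ := by
      have := hI τ
      rw [h1w]
      field_simp
      ring
    simp only [hpt] at h2
    simp only [h1w] at h2
    convert! h2 using 1
    have := hI τ
    simp only [Function.comp_apply, UpperHalfPlane.ofComplex_apply]
    field_simp
    ring
  refine ⟨fun τ => (2 * Real.pi * Complex.I) * g (((τ : ℂ) - Complex.I) / (τ + Complex.I)),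
    ?_, ?_⟩
  · rw [UpperHalfPlane.mdifferentiable_iff]
    intro z hz
    refine DifferentiableAt.differentiableWithinAt ?_
    refine ((hder ⟨z, hz⟩).differentiableAt.const_mul (2 * Real.pi * Complex.I)).congr_of_eventuallyEq
      ?_
    filter_upwards [UpperHalfPlane.isOpen_upperHalfPlaneSet.mem_nhds hz] with w hw
    simp [UpperHalfPlane.ofComplex_apply_of_im_pos hw]
  · ext τ
    have : HasDerivAt ((fun τ : ℍ => (2 * Real.pi * Complex.I) *
        g (((τ : ℂ) - Complex.I) / (τ + Complex.I))) ∘ UpperHalfPlane.ofComplex)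
        ((2 * Real.pi * Complex.I) * F τ) τ := by
      refine ((hder τ).const_mul (2 * Real.pi * Complex.I)).congr_of_eventuallyEq ?_
      filter_upwards [UpperHalfPlane.isOpen_upperHalfPlaneSet.mem_nhds τ.im_pos] with w hw
      simp [UpperHalfPlane.ofComplex_apply_of_im_pos hw]
    rw [Derivative.normalizedDerivOfComplex, this.deriv, inv_mul_cancel_left₀]
    exact Complex.two_pi_I_ne_zero

/-- A holomorphic function on the upper half-plane with zero derivative is constant. -/
theorem UpperHalfPlane.eq_of_normalizedDeriv_eq_zero {H : ℍ → ℂ} (hH : MDiff H)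
    (hD : Derivative.normalizedDerivOfComplex H = 0) (τ σ : ℍ) : H τ = H σ := by
  rw [UpperHalfPlane.mdifferentiable_iff] at hH
  have := UpperHalfPlane.isOpen_upperHalfPlaneSet.is_const_of_deriv_eq_zero
    (convex_halfSpace_im_gt 0).isPreconnected hH (fun z hz => ?_) τ.im_pos σ.im_pos
  · simpa using this
  · have h := congrFun hD ⟨z, hz⟩
    simpa [Derivative.normalizedDerivOfComplex, Complex.two_pi_I_ne_zero] using h

/-- The factor $-1/12$ turns $D+kE_2$ of condition (4) into the Serre derivative of weight $k$. -/
theorem eisenTwo_eq (τ : ℍ) : eisenTwo τ = -(12 : ℂ)⁻¹ * EisensteinSeries.E2 τ := by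
  rw [eisenTwo, EisensteinSeries.E2, Pi.smul_apply, riemannZeta_two, smul_eq_mul]
  have : (Real.pi : ℂ) ≠ 0 := by exact_mod_cast Real.pi_ne_zero
  rw [mul_pow, Complex.I_sq]
  field_simp
  ring

/-- The logarithm of the automorphy factor `cτ+d` is differentiable. -/
theorem hasDerivAt_log_denom (γ : SL(2, ℤ)) (τ : ℍ) :
    HasDerivAt (fun z : ℂ => Complex.log (UpperHalfPlane.denom γ z))
      ((γ 1 0 : ℂ) / UpperHalfPlane.denom γ τ) τ := by
  have hden : ∀ z : ℂ, UpperHalfPlane.denom γ z = (γ 1 0 : ℂ) * z + γ 1 1 := fun z => by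
    simp [UpperHalfPlane.denom]
  by_cases hc : γ 1 0 = 0
  · simp only [hden, hc, Int.cast_zero, zero_mul, zero_add, zero_div]
    exact hasDerivAt_const _ _
  · simp only [hden]
    have h1 : HasDerivAt (fun z : ℂ => (γ 1 0 : ℂ) * z + γ 1 1) (γ 1 0 : ℂ) τ := by
      simpa using ((hasDerivAt_id (τ : ℂ)).const_mul (γ 1 0 : ℂ)).add_const (γ 1 1 : ℂ)
    refine h1.clog ?_
    refine Complex.mem_slitPlane_iff.mpr (Or.inr ?_)
    simp [hc, τ.im_pos.ne']

theorem mdifferentiable_log_denom (γ : SL(2, ℤ)) :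
    MDiff (fun τ : ℍ => Complex.log (UpperHalfPlane.denom γ τ)) := by
  rw [UpperHalfPlane.mdifferentiable_iff]
  intro z hz
  refine ((hasDerivAt_log_denom γ ⟨z, hz⟩).differentiableAt.congr_of_eventuallyEq
    ?_).differentiableWithinAt
  filter_upwards [UpperHalfPlane.isOpen_upperHalfPlaneSet.mem_nhds hz] with w hw
  simp [UpperHalfPlane.ofComplex_apply_of_im_pos hw]

theorem normalizedDeriv_log_denom (γ : SL(2, ℤ)) (τ : ℍ) :
    Derivative.normalizedDerivOfComplex
      (fun τ : ℍ => Complex.log (UpperHalfPlane.denom γ τ)) τ =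
      (2 * Real.pi * Complex.I)⁻¹ * ((γ 1 0 : ℂ) / UpperHalfPlane.denom γ τ) := by
  rw [Derivative.normalizedDerivOfComplex]
  congr 1
  refine ((hasDerivAt_log_denom γ τ).congr_of_eventuallyEq ?_).deriv
  filter_upwards [UpperHalfPlane.isOpen_upperHalfPlaneSet.mem_nhds τ.im_pos] with w hw
  simp [UpperHalfPlane.ofComplex_apply_of_im_pos hw]

open ModularForm in
/-- A holomorphic function `ℓ` with `D ℓ = E_2 / 12` (so `ℓ = 2 log η` up to a constant) satisfies
`ℓ(γτ) = ℓ(τ) + log(cτ+d) + κ(γ)`. -/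
theorem logEta_smul {ℓ : ℍ → ℂ} (hℓ : MDiff ℓ)
    (hD : Derivative.normalizedDerivOfComplex ℓ = (12 : ℂ)⁻¹ • EisensteinSeries.E2)
    (γ : SL(2, ℤ)) : ∃ κ : ℂ, ∀ τ : ℍ,
      ℓ (γ • τ) = ℓ τ + Complex.log (UpperHalfPlane.denom γ τ) + κ := by
  have hcomp : (ℓ ∣[(0 : ℤ)] γ) = fun τ => ℓ (γ • τ) := by
    ext τ; simp [ModularForm.SL_slash_apply]
  have hmd : MDiff (ℓ ∣[(0 : ℤ)] γ) := by
    rw [hcomp]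
    exact hℓ.comp (UpperHalfPlane.mdifferentiable_smul (g := (γ : GL (Fin 2) ℝ)) (by simp))
  have hmd' := (hmd.sub hℓ).sub (mdifferentiable_log_denom γ)
  refine ⟨ℓ (γ • UpperHalfPlane.I) - ℓ UpperHalfPlane.I -
    Complex.log (UpperHalfPlane.denom γ UpperHalfPlane.I), fun τ => ?_⟩
  have := UpperHalfPlane.eq_of_normalizedDeriv_eq_zero hmd' ?_ τ UpperHalfPlane.I
  · rw [hcomp] at this
    simp only [Pi.sub_apply] at this
    linear_combination this
  -- The anomaly of `E2` under `γ` is exactly cancelled by the derivative of $\log(c\tau+d)$, so the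
  -- difference is constant.
  · rw [Derivative.normalizedDerivOfComplex_sub _ _ (hmd.sub hℓ) (mdifferentiable_log_denom γ),
      Derivative.normalizedDerivOfComplex_sub _ _ hmd hℓ,
      Derivative.normalizedDerivOfComplex_SL_slash hℓ, hD]
    ext τ
    have hE2 := congrFun (EisensteinSeries.E2_slash_action γ) τ
    simp only [Pi.sub_apply, Pi.smul_apply, smul_eq_mul, EisensteinSeries.D2,
      riemannZeta_two] at hE2
    simp only [Pi.sub_apply, normalizedDeriv_log_denom, zero_add, ModularForm.SL_smul_slash,
      Pi.smul_apply, smul_eq_mul, hE2, Int.cast_zero, zero_mul, sub_zero, Pi.zero_apply]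
    have hpi : (Real.pi : ℂ) ≠ 0 := by exact_mod_cast Real.pi_ne_zero
    have hden := UpperHalfPlane.denom_ne_zero (γ : GL (Fin 2) ℝ) τ
    field_simp
    linear_combination (-12 : ℂ) * (γ 1 0 : ℂ) * Complex.I_sq

theorem denom_mul (γ δ : SL(2, ℤ)) (τ : ℍ) :
    UpperHalfPlane.denom (γ * δ : SL(2, ℤ)) τ =
      UpperHalfPlane.denom γ ((δ • τ : ℍ) : ℂ) * UpperHalfPlane.denom δ τ := by
  have h := UpperHalfPlane.denom_cocycle_σ (γ : GL (Fin 2) ℝ) (δ : GL (Fin 2) ℝ) τ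
  rw [map_mul]
  simpa [UpperHalfPlane.σ] using h

/-- The branch of the logarithm affects only imaginary parts. Since $\log|c\tau+d|$ is an additive
cocycle, $\mathrm{Re}\,\kappa$ is a homomorphism and is determined on the generators. -/
theorem logEta_const_re {ℓ : ℍ → ℂ} {κ : SL(2, ℤ) → ℂ}
    (hκ : ∀ (γ : SL(2, ℤ)) (τ : ℍ),
      ℓ (γ • τ) = ℓ τ + Complex.log (UpperHalfPlane.denom γ τ) + κ γ)
    (hS : (κ ModularGroup.S).re = 0) (hT : (κ ModularGroup.T).re = 0) (γ : SL(2, ℤ)) :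
    (κ γ).re = 0 := by
  have hmul : ∀ γ δ : SL(2, ℤ), (κ (γ * δ)).re = (κ γ).re + (κ δ).re := by
    intro γ δ
    have h1 := congrArg Complex.re (hκ (γ * δ) UpperHalfPlane.I)
    have h2 := congrArg Complex.re (hκ γ (δ • UpperHalfPlane.I))
    have h3 := congrArg Complex.re (hκ δ UpperHalfPlane.I)
    rw [mul_smul] at h1
    simp only [Complex.add_re, Complex.log_re] at h1 h2 h3
    rw [denom_mul, norm_mul, Real.log_mul
      (norm_ne_zero_iff.mpr (UpperHalfPlane.denom_ne_zero _ _))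
      (norm_ne_zero_iff.mpr (UpperHalfPlane.denom_ne_zero _ _))] at h1
    linarith
  have hone : (κ 1).re = 0 := by simpa using hmul 1 1
  have hγ : γ ∈ Subgroup.closure {ModularGroup.S, ModularGroup.T} := by
    simp [SpecialLinearGroup.SL2Z_generators]
  induction hγ using Subgroup.closure_induction with
  | mem x hx =>
    rcases hx with rfl | rfl
    · exact hS
    · exact hT
  | one => exact hone
  | mul x y _ _ hx hy => rw [hmul, hx, hy, add_zero]
  | inv x _ hx =>
    have := hmul x x⁻¹
    rw [mul_inv_cancel, hone, hx] at this
    linarith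

/-- At the fixed point $i$ of $S$ the values of `ℓ` cancel and leave $0=\log i+\kappa$. -/
theorem logEta_const_S {ℓ : ℍ → ℂ} {κ : ℂ}
    (hκ : ∀ τ : ℍ, ℓ (ModularGroup.S • τ) =
      ℓ τ + Complex.log (UpperHalfPlane.denom ModularGroup.S τ) + κ) :
    κ = -(Real.pi / 2 * Complex.I) := by
  have h := hκ UpperHalfPlane.I
  have hfix : ModularGroup.S • UpperHalfPlane.I = UpperHalfPlane.I := by
    ext
    rw [UpperHalfPlane.modular_S_smul]
    simp
  rw [hfix, ModularGroup.denom_S, UpperHalfPlane.coe_I, Complex.log_I] at h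
  linear_combination -h

theorem logEta_const_T {ℓ : ℍ → ℂ} {κ κ' : ℂ}
    (hκ : ∀ τ : ℍ, ℓ (ModularGroup.S • τ) =
      ℓ τ + Complex.log (UpperHalfPlane.denom ModularGroup.S τ) + κ)
    (hκ' : ∀ τ : ℍ, ℓ (ModularGroup.T • τ) =
      ℓ τ + Complex.log (UpperHalfPlane.denom ModularGroup.T τ) + κ') :
    κ' = Real.pi / 6 * Complex.I := by
  have him : 0 < (Complex.exp (Real.pi / 3 * Complex.I)).im := by
    have : (Real.pi / 3 * Complex.I : ℂ) = ((Real.pi / 3 : ℝ) : ℂ) * Complex.I := by push_cast; rfl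
    rw [this, Complex.exp_ofReal_mul_I_im]
    exact Real.sin_pos_of_pos_of_lt_pi (by positivity) (by linarith [Real.pi_pos])
  -- $e^{\pi i/3}$ is fixed by $TS$, so going around gives $0=\frac{\pi i}3-\frac{\pi
  -- i}2+\kappa(T)$.
  let σ : ℍ := ⟨Complex.exp (Real.pi / 3 * Complex.I), him⟩
  have hσ : (σ : ℂ) = Complex.exp (Real.pi / 3 * Complex.I) := rfl
  have hσ2 : (σ : ℂ) * σ = σ - 1 := by
    have h3 : (σ : ℂ) ^ 3 = -1 := by
      rw [hσ, ← Complex.exp_nat_mul, ← Complex.exp_pi_mul_I]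
      congr 1
      push_cast; ring
    have hne : (σ : ℂ) + 1 ≠ 0 := by
      intro h
      have := congrArg Complex.im h
      simp at this
      exact σ.im_pos.ne' this
    have : ((σ : ℂ) + 1) * ((σ : ℂ) * σ - σ + 1) = 0 := by linear_combination h3
    rcases mul_eq_zero.mp this with h | h
    · exact absurd h hne
    · linear_combination h
  have hfix : ModularGroup.T • (ModularGroup.S • σ) = σ := by
    ext
    rw [UpperHalfPlane.modular_T_smul, UpperHalfPlane.modular_S_smul]
    have := σ.ne_zero
    simp
    field_simp
    linear_combination -hσ2
  have h1 := hκ σ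
  have h2 := hκ' (ModularGroup.S • σ)
  have hdT : UpperHalfPlane.denom ModularGroup.T ((ModularGroup.S • σ : ℍ) : ℂ) = 1 := by
    rw [ModularGroup.denom_apply]; simp [ModularGroup.T]
  have hlog : Complex.log (σ : ℂ) = Real.pi / 3 * Complex.I := by
    rw [hσ, Complex.log_exp]
    · simp; linarith [Real.pi_pos]
    · simp; linarith [Real.pi_pos]
  rw [hfix, h1, hdT, ModularGroup.denom_S, hlog, Complex.log_one, logEta_const_S hκ] at h2
  linear_combination -h2

/-- `2 log η` up to a constant, with its transformation behaviour. -/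
theorem exists_logEta : ∃ (ℓ : ℍ → ℂ) (κ : SL(2, ℤ) → ℂ), MDiff ℓ ∧
    Derivative.normalizedDerivOfComplex ℓ = (12 : ℂ)⁻¹ • EisensteinSeries.E2 ∧
    (∀ (γ : SL(2, ℤ)) (τ : ℍ),
      ℓ (γ • τ) = ℓ τ + Complex.log (UpperHalfPlane.denom γ τ) + κ γ) ∧
    (∀ γ, (κ γ).re = 0) ∧ κ ModularGroup.S = -(Real.pi / 2 * Complex.I) ∧
    κ ModularGroup.T = Real.pi / 6 * Complex.I := by
  obtain ⟨ℓ, hℓ, hD⟩ := UpperHalfPlane.exists_normalizedDeriv_eq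
    (E2_mdifferentiable.const_smul (12 : ℂ)⁻¹)
  choose κ hκ using logEta_smul hℓ hD
  have hS := logEta_const_S (hκ ModularGroup.S)
  have hT := logEta_const_T (hκ ModularGroup.S) (hκ ModularGroup.T)
  refine ⟨ℓ, κ, hℓ, hD, hκ, logEta_const_re hκ ?_ ?_, hS, hT⟩
  · simp [hS]
  · simp [hT]

/-! ### Serre derivatives and the slash action twisted by $e^{t\ell}$. -/

theorem eisen_smul (n : ℕ) (γ : SL(2, ℤ)) (τ : ℍ) :
    (eisen n : ℍ → ℂ) (γ • τ) =
      UpperHalfPlane.denom γ τ ^ (2 * (n : ℤ) + 4) * (eisen n : ℍ → ℂ) τ := by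
  have h := SlashInvariantForm.slash_action_eqn'' (Γ := 𝒮ℒ)
    (ModularForm.E (three_le_two_mul_add_four n)) (γ := (γ : GL (Fin 2) ℝ)) ⟨γ, rfl⟩ τ
  simp only [eisen, Pi.smul_apply, smul_eq_mul]
  rw [ModularGroup.sl_moeb, h]
  push_cast
  ring

theorem modularRing_mdifferentiable (f : modularRing) : MDiff (f : ℍ → ℂ) := by
  obtain ⟨f, hf⟩ := f
  induction hf using Algebra.adjoin_induction with
  | mem x hx =>
    obtain ⟨k, F, rfl⟩ := hx
    exact F.holo'
  | algebraMap c => exact mdifferentiable_const (c := c)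
  | add x y _ _ hx hy => exact MDifferentiable.add hx hy
  | mul x y _ _ hx hy => exact MDifferentiable.mul hx hy

/-- `e^{tℓ}` is holomorphic. -/
theorem mdifferentiable_exp_smul {ℓ : ℍ → ℂ} (hℓ : MDiff ℓ) (s : ℂ) :
    MDiff (fun τ : ℍ => Complex.exp (s * ℓ τ)) := by
  have hd : Differentiable ℂ fun z : ℂ => Complex.exp (s * z) := by fun_prop
  exact hd.comp_mdifferentiable hℓ

theorem normalizedDeriv_exp_smul {ℓ : ℍ → ℂ} (hℓ : MDiff ℓ) (s : ℂ) (τ : ℍ) :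
    Derivative.normalizedDerivOfComplex (fun τ : ℍ => Complex.exp (s * ℓ τ)) τ =
      s * Derivative.normalizedDerivOfComplex ℓ τ * Complex.exp (s * ℓ τ) := by
  have h := (UpperHalfPlane.mdifferentiableAt_iff.mp (hℓ τ)).hasDerivAt
  have h2 := (h.const_mul s).cexp.deriv
  simp only [Function.comp_apply, UpperHalfPlane.ofComplex_apply] at h2
  rw [Derivative.normalizedDerivOfComplex, Derivative.normalizedDerivOfComplex]
  change _ * deriv (fun z => Complex.exp (s * (ℓ (UpperHalfPlane.ofComplex z)))) τ = _
  rw [h2]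
  ring

/-- If `D ℓ = E_2/12`, multiplication by `e^{sℓ}` raises the weight of the Serre derivative
by `s`. -/
theorem serreDerivative_exp_mul {ℓ : ℍ → ℂ} (hℓ : MDiff ℓ)
    (hD : Derivative.normalizedDerivOfComplex ℓ = (12 : ℂ)⁻¹ • EisensteinSeries.E2)
    (s k : ℂ) {f : ℍ → ℂ} (hf : MDiff f) (τ : ℍ) :
    Derivative.serreDerivative (s + k) ((fun τ => Complex.exp (s * ℓ τ)) * f) τ =
      Complex.exp (s * ℓ τ) * Derivative.serreDerivative k f τ := by
  simp only [Derivative.serreDerivative_apply]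
  rw [Derivative.normalizedDerivOfComplex_mul _ _ (mdifferentiable_exp_smul hℓ s) hf]
  simp only [Pi.add_apply, Pi.mul_apply, normalizedDeriv_exp_smul hℓ, hD, Pi.smul_apply,
    smul_eq_mul]
  ring

/-- The operator `f ↦ e^{tℓ} ((e^{-tℓ} f) ∣[k] γ)` commutes with Serre derivatives. -/
theorem serreDerivative_twisted_slash {ℓ : ℍ → ℂ} (hℓ : MDiff ℓ)
    (hD : Derivative.normalizedDerivOfComplex ℓ = (12 : ℂ)⁻¹ • EisensteinSeries.E2)
    (t : ℂ) (k : ℤ) {f : ℍ → ℂ} (hf : MDiff f) (γ : SL(2, ℤ)) (τ : ℍ) :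
    Derivative.serreDerivative (t + k) (fun τ => Complex.exp (t * (ℓ τ - ℓ (γ • τ))) *
        UpperHalfPlane.denom γ τ ^ (-k) * f (γ • τ)) τ =
      Complex.exp (t * (ℓ τ - ℓ (γ • τ))) * UpperHalfPlane.denom γ τ ^ (-(k + 2)) *
        Derivative.serreDerivative (t + k) f (γ • τ) := by
  -- Multiplication by $e^{-t\ell}$ moves `f` from weight $t+k$ to the integral weight $k$, where
  -- the Serre derivative is slash equivariant; $e^{t\ell}$ moves the result back.
  open ModularForm in
  set h : ℍ → ℂ := (fun τ => Complex.exp (-t * ℓ τ)) * f with hh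
  have hhd : MDiff h := (mdifferentiable_exp_smul hℓ (-t)).mul hf
  have hexp : ∀ τ, Complex.exp (t * (ℓ τ - ℓ (γ • τ))) =
      Complex.exp (t * ℓ τ) * Complex.exp (-t * ℓ (γ • τ)) := by
    intro τ
    rw [← Complex.exp_add]
    congr 1; ring
  have e1 : (fun τ => Complex.exp (t * (ℓ τ - ℓ (γ • τ))) *
      UpperHalfPlane.denom γ τ ^ (-k) * f (γ • τ)) =
      (fun τ => Complex.exp (t * ℓ τ)) * (h ∣[k] γ) := by
    ext τ
    simp only [hexp, hh, Pi.mul_apply, ModularForm.SL_slash_apply]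
    ring
  have hslash : MDiff (h ∣[k] γ) := by
    have : h ∣[k] γ = fun τ => h (γ • τ) * UpperHalfPlane.denom γ τ ^ (-k) := by
      ext τ; rw [ModularForm.SL_slash_apply]
    rw [this]
    exact (hhd.comp (UpperHalfPlane.mdifferentiable_smul (g := (γ : GL (Fin 2) ℝ)) (by simp))).mul
      (UpperHalfPlane.mdifferentiable_denom_zpow _ _)
  rw [e1, serreDerivative_exp_mul hℓ hD t k hslash, ← Derivative.serreDerivative_slash_equivariant
    hhd, ModularForm.SL_slash_apply, hexp]
  have e2 := serreDerivative_exp_mul hℓ hD (-t) (t + k) hf (γ • τ)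
  rw [neg_add_cancel_left] at e2
  rw [hh, e2]
  ring

/-! ### The right action of $SL(2,\mathbb Z)$ on one-point functions. -/

namespace VOAModule

variable {V : Type*} [AddCommGroup V] [Module ℂ V] {A : VertexOperatorAlgebra V}
  {U : Type*} [AddCommGroup U] [Module ℂ U]

/-- The linear map on `U` that is `φ n` on the weight space `U_[r+n]`. -/
def gradedLift (M : VOAModule A U) {X : Type*} [AddCommGroup X] [Module ℂ X]
    (φ : ℕ → U →ₗ[ℂ] X) : U →ₗ[ℂ] X :=
  DirectSum.toModule ℂ ℕ X (fun n => φ n ∘ₗ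
      (Module.End.eigenspace M.sqLZero (M.lowestWeight + n)).subtype) ∘ₗ
    (LinearEquiv.ofBijective (DirectSum.coeLinearMap
      fun n : ℕ => Module.End.eigenspace M.sqLZero (M.lowestWeight + n))
      M.isInternal_sqLZero).symm.toLinearMap

theorem gradedLift_apply (M : VOAModule A U) {X : Type*} [AddCommGroup X] [Module ℂ X]
    (φ : ℕ → U →ₗ[ℂ] X) {n : ℕ} {u : U} (hu : u ∈ M.sqWeight (M.lowestWeight + n)) :
    M.gradedLift φ u = φ n u := by
  rw [mem_sqWeight] at hu
  let e := LinearEquiv.ofBijective (DirectSum.coeLinearMap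
      fun n : ℕ => Module.End.eigenspace M.sqLZero (M.lowestWeight + n)) M.isInternal_sqLZero
  have he : e.symm u = DirectSum.lof ℂ ℕ
      (fun n : ℕ => Module.End.eigenspace M.sqLZero (M.lowestWeight + n)) n ⟨u, hu⟩ := by
    rw [LinearEquiv.symm_apply_eq]
    exact (DirectSum.coeLinearMap_lof
      (fun n : ℕ => Module.End.eigenspace M.sqLZero (M.lowestWeight + n)) n ⟨u, hu⟩).symm
  change DirectSum.toModule ℂ ℕ X _ (e.symm u) = _
  rw [he, DirectSum.toModule_lof]
  rfl

theorem sqWeight_induction (M : VOAModule A U) {P : U → Prop} (hzero : P 0)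
    (hadd : ∀ u v, P u → P v → P (u + v))
    (hmem : ∀ (n : ℕ), ∀ u ∈ M.sqWeight (M.lowestWeight + n), P u) (u : U) : P u := by
  have hu : u ∈ ⨆ n : ℕ, Module.End.eigenspace M.sqLZero (M.lowestWeight + n) := by
    rw [M.iSup_eigenspace_sqLZero]; trivial
  induction hu using Submodule.iSup_induction' with
  | mem n x hx => exact hmem n x (M.mem_sqWeight.mpr hx)
  | zero => exact hzero
  | add x y _ _ hx hy => exact hadd x y hx hy

/-- The values of `F|γ` on the weight space `U_[r+n]`, where `K = w + n`. -/
def slashWeight (F : (modularRing ⊗[ℂ] U) →ₗ[ℂ] (ℍ → ℂ)) (ℓ : ℍ → ℂ) (t : ℂ)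
    (γ : SL(2, ℤ)) (K : ℤ) : U →ₗ[ℂ] (ℍ → ℂ) where
  toFun u τ := Complex.exp (t * (ℓ τ - ℓ (γ • τ))) * UpperHalfPlane.denom γ τ ^ (-K) *
    F (1 ⊗ₜ[ℂ] u) (γ • τ)
  map_add' u v := by
    ext τ
    simp [TensorProduct.tmul_add, mul_add]
  map_smul' c u := by
    ext τ
    simp only [TensorProduct.tmul_smul, map_smul, Pi.smul_apply, smul_eq_mul, RingHom.id_apply]
    ring

/-- The function `F|γ` on `M(Γ(1)) ⊗ U`. -/
def slashMap (M : VOAModule A U) (F : (modularRing ⊗[ℂ] U) →ₗ[ℂ] (ℍ → ℂ)) (ℓ : ℍ → ℂ) (t : ℂ)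
    (w : ℤ) (γ : SL(2, ℤ)) : (modularRing ⊗[ℂ] U) →ₗ[ℂ] (ℍ → ℂ) :=
  TensorProduct.lift ((LinearMap.mul ℂ (ℍ → ℂ)).compl₁₂ modularRing.val.toLinearMap
    (M.gradedLift fun n => slashWeight F ℓ t γ (w + n)))

/-- The degree `q` is allowed to be any integer because modes can shift below the lowest weight; for
negative `q` the vector is zero and both sides vanish. The coefficient `f` is not moved by `γ`,
which keeps the map linear over `modularRing`. -/
theorem slashMap_tmul (M : VOAModule A U) (F : (modularRing ⊗[ℂ] U) →ₗ[ℂ] (ℍ → ℂ)) (ℓ : ℍ → ℂ)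
    (t : ℂ) (w : ℤ) (γ : SL(2, ℤ)) (f : modularRing) {q : ℤ} {u : U}
    (hu : u ∈ M.sqWeight (M.lowestWeight + q)) (τ : ℍ) :
    M.slashMap F ℓ t w γ (f ⊗ₜ[ℂ] u) τ = (f : ℍ → ℂ) τ *
      (Complex.exp (t * (ℓ τ - ℓ (γ • τ))) * UpperHalfPlane.denom γ τ ^ (-(w + q)) *
        F (1 ⊗ₜ[ℂ] u) (γ • τ)) := by
  by_cases h0 : u = 0
  · simp [h0]
  · obtain ⟨n, hn⟩ := M.exists_nat_of_mem_sqWeight hu h0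
    have hq : q = n := by
      have := add_left_cancel hn
      exact_mod_cast this
    subst hq
    change ((f : ℍ → ℂ) * M.gradedLift (fun n => slashWeight F ℓ t γ (w + n)) u) τ = _
    rw [M.gradedLift_apply _ (by simpa using hu)]
    rfl

theorem slashMap_smul (M : VOAModule A U) (F : (modularRing ⊗[ℂ] U) →ₗ[ℂ] (ℍ → ℂ)) (ℓ : ℍ → ℂ)
    (t : ℂ) (w : ℤ) (γ : SL(2, ℤ)) (f : modularRing) (x : modularRing ⊗[ℂ] U) (τ : ℍ) :
    M.slashMap F ℓ t w γ (f • x) τ = (f : ℍ → ℂ) τ * M.slashMap F ℓ t w γ x τ := by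
  induction x using TensorProduct.induction_on with
  | zero => simp
  | tmul g u =>
    rw [TensorProduct.smul_tmul']
    simp [slashMap, mul_assoc]
  | add x y hx hy =>
    rw [smul_add, map_add, map_add, Pi.add_apply, Pi.add_apply, hx, hy, mul_add]

theorem slashMap_mdifferentiable (M : VOAModule A U) {F : (modularRing ⊗[ℂ] U) →ₗ[ℂ] (ℍ → ℂ)}
    (hF : ∀ x, MDiff (F x)) {ℓ : ℍ → ℂ} (hℓ : MDiff ℓ)
    (t : ℂ) (w : ℤ) (γ : SL(2, ℤ)) (x : modularRing ⊗[ℂ] U) :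
    MDiff (M.slashMap F ℓ t w γ x) := by
  induction x using TensorProduct.induction_on with
  | zero =>
    rw [map_zero]
    exact mdifferentiable_const (c := (0 : ℂ))
  | add x y hx hy =>
    rw [map_add]
    exact hx.add hy
  | tmul f u =>
    induction u using M.sqWeight_induction with
    | hzero =>
      rw [TensorProduct.tmul_zero, map_zero]
      exact mdifferentiable_const (c := (0 : ℂ))
    | hadd u v hu hv =>
      rw [TensorProduct.tmul_add, map_add]
      exact hu.add hv
    | hmem n u hu =>
      have hsmul : MDiff (fun τ : ℍ => γ • τ) :=
        UpperHalfPlane.mdifferentiable_smul (g := (γ : GL (Fin 2) ℝ)) (by simp)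
      have heq : M.slashMap F ℓ t w γ (f ⊗ₜ[ℂ] u) = (f : ℍ → ℂ) *
          ((fun τ => Complex.exp (t * (ℓ - fun τ => ℓ (γ • τ)) τ)) *
            (fun τ : ℍ => UpperHalfPlane.denom γ τ ^ (-(w + n))) *
            (fun τ => F (1 ⊗ₜ[ℂ] u) (γ • τ))) := by
        ext τ
        rw [M.slashMap_tmul F ℓ t w γ f (q := n) (by simpa using hu)]
        rfl
      rw [heq]
      exact (modularRing_mdifferentiable f).mul
        (((mdifferentiable_exp_smul (hℓ.sub (hℓ.comp hsmul)) t).mul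
          (UpperHalfPlane.mdifferentiable_denom_zpow _ _)).mul ((hF _).comp hsmul))

/-- The transformation of the Eisenstein sums in the axioms of one-point functions. -/
theorem slashMap_eisen_sum (M : VOAModule A U) {F : (modularRing ⊗[ℂ] U) →ₗ[ℂ] (ℍ → ℂ)}
    (hF : ∀ (f : modularRing) (x : modularRing ⊗[ℂ] U) (τ : ℍ),
      F (f • x) τ = (f : ℍ → ℂ) τ * F x τ)
    (ℓ : ℍ → ℂ) (t : ℂ) (w : ℤ) (γ : SL(2, ℤ)) (c : ℕ → ℂ) (y : ℕ → U) {q : ℤ}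
    (hy : ∀ n : ℕ, y n ∈ M.sqWeight (M.lowestWeight + ((q - (2 * n + 4) : ℤ) : ℂ)))
    (hfin : ∃ N : ℕ, ∀ n, N ≤ n → y n = 0) (τ : ℍ) :
    M.slashMap F ℓ t w γ (∑ᶠ n : ℕ, c n • (eisen n ⊗ₜ[ℂ] y n)) τ =
      Complex.exp (t * (ℓ τ - ℓ (γ • τ))) * UpperHalfPlane.denom γ τ ^ (-(w + q)) *
        F (∑ᶠ n : ℕ, c n • (eisen n ⊗ₜ[ℂ] y n)) (γ • τ) := by
  obtain ⟨N, hN⟩ := hfin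
  rw [finsum_eq_finsetSum_of_support_subset (s := Finset.range N)]
  · simp only [map_sum, map_smul, Finset.sum_apply, Pi.smul_apply, smul_eq_mul, Finset.mul_sum]
    refine Finset.sum_congr rfl fun n _ => ?_
    -- The weight $2n+4$ of `eisen n` compensates the lower degree of `y n`, so every term carries
    -- the same automorphy factor.
    have e1 : eisen n ⊗ₜ[ℂ] y n = eisen n • ((1 : modularRing) ⊗ₜ[ℂ] y n) := by
      rw [TensorProduct.smul_tmul', smul_eq_mul, mul_one]
    rw [M.slashMap_tmul F ℓ t w γ (eisen n) (hy n), e1, hF, eisen_smul]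
    have hden := UpperHalfPlane.denom_ne_zero (γ : GL (Fin 2) ℝ) τ
    have e2 : UpperHalfPlane.denom γ τ ^ (-(w + (q - (2 * (n : ℤ) + 4)))) =
        UpperHalfPlane.denom γ τ ^ (-(w + q)) * UpperHalfPlane.denom γ τ ^ (2 * (n : ℤ) + 4) := by
      rw [← zpow_add₀ hden]
      congr 1; ring
    rw [e2]
    ring
  · intro n hn
    by_contra h
    simp only [Finset.coe_range, Set.mem_Iio, not_lt] at h
    exact hn (by simp [hN n h])

/-- The second family of generators of `O_q(U)`. -/
def oqGen (M : VOAModule A U) (v : V) (u : U) : modularRing ⊗[ℂ] U :=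
  (1 : modularRing) ⊗ₜ[ℂ] M.sqMode v (-2) u +
    ∑ᶠ n : ℕ, ((2 * n + 3 : ℕ) : ℂ) • (eisen n ⊗ₜ[ℂ] M.sqMode v (2 * n + 2) u)

theorem oqGen_support_finite (M : VOAModule A U) (v : V) (u : U) :
    (Function.support fun n : ℕ =>
      ((2 * n + 3 : ℕ) : ℂ) • (eisen n ⊗ₜ[ℂ] M.sqMode v (2 * n + 2) u)).Finite := by
  obtain ⟨N, hN⟩ := M.sqMode_truncation v u
  refine (Set.finite_lt_nat N.toNat).subset fun n hn => ?_
  by_contra h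
  refine hn ?_
  simp only [Set.mem_ofPred_eq, not_lt] at h
  simp only [hN (2 * n + 2) (by omega), TensorProduct.tmul_zero, smul_zero]

theorem oqGen_add_left (M : VOAModule A U) (v v' : V) (u : U) :
    M.oqGen (v + v') u = M.oqGen v u + M.oqGen v' u := by
  simp only [oqGen]
  rw [add_add_add_comm, ← finsum_add_distrib (M.oqGen_support_finite v u)
    (M.oqGen_support_finite v' u)]
  simp only [sqMode_eq, map_add, LinearMap.add_apply, TensorProduct.tmul_add, smul_add]

theorem oqGen_add_right (M : VOAModule A U) (v : V) (u u' : U) :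
    M.oqGen v (u + u') = M.oqGen v u + M.oqGen v u' := by
  simp only [oqGen]
  rw [add_add_add_comm, ← finsum_add_distrib (M.oqGen_support_finite v u)
    (M.oqGen_support_finite v u')]
  simp only [sqMode_eq, map_add, TensorProduct.tmul_add, smul_add]

/-- The $L[0]$-weights on `V` are integers, so $v[j]u$ stays in weights $r+\mathbb Z$ for
homogeneous `v` and `u`. -/
theorem exists_int_adjoint_lowestWeight (A : VertexOperatorAlgebra V) :
    ∃ N : ℤ, A.adjoint.lowestWeight = N := ⟨_, rfl⟩

theorem slashMap_oq (M : VOAModule A U) {F : (modularRing ⊗[ℂ] U) →ₗ[ℂ] (ℍ → ℂ)}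
    (hF : ∀ (f : modularRing) (x : modularRing ⊗[ℂ] U) (τ : ℍ),
      F (f • x) τ = (f : ℍ → ℂ) τ * F x τ)
    (hFO : ∀ x ∈ M.Oq, ∀ τ : ℍ, F x τ = 0)
    (ℓ : ℍ → ℂ) (t : ℂ) (w : ℤ) (γ : SL(2, ℤ)) (x : modularRing ⊗[ℂ] U) (hx : x ∈ M.Oq) (τ : ℍ) :
    M.slashMap F ℓ t w γ x τ = 0 := by
  obtain ⟨N₀, hN₀⟩ := exists_int_adjoint_lowestWeight A
  have hmem : ∀ {v : V} {u : U} {a b : ℕ} (j : ℤ),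
      v ∈ A.adjoint.sqWeight (A.adjoint.lowestWeight + a) →
      u ∈ M.sqWeight (M.lowestWeight + b) →
      M.sqMode v j u ∈ M.sqWeight (M.lowestWeight + ((b + N₀ + a - j - 1 : ℤ) : ℂ)) := by
    intro v u a b j hv hu
    have := M.sqMode_mem_sqWeight j
      (Module.End.mem_eigenspace_iff.mp (A.adjoint.mem_sqWeight.mp hv)) hu
    rw [hN₀] at this
    convert! this using 2
    push_cast; ring
  induction hx using Submodule.span_induction with
  | zero => simp
  | add x y _ _ hx hy => rw [map_add, Pi.add_apply, hx, hy, add_zero]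
  | smul f x _ hx => rw [slashMap_smul, hx, mul_zero]
  | mem x hx =>
    rcases hx with ⟨v, u, rfl⟩ | ⟨v, u, rfl⟩
    · induction v using A.adjoint.sqWeight_induction with
      | hzero => simp [sqMode_eq]
      | hadd v v' hv hv' =>
        rw [sqMode_eq] at hv hv' ⊢
        rw [map_add, LinearMap.add_apply, TensorProduct.tmul_add, map_add, Pi.add_apply, hv, hv',
          add_zero]
      | hmem a v hv =>
        induction u using M.sqWeight_induction with
        | hzero => simp [sqMode_eq]
        | hadd u u' hu hu' =>
          rw [sqMode_eq] at hu hu' ⊢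
          rw [map_add, TensorProduct.tmul_add, map_add, Pi.add_apply, hu, hu', add_zero]
        | hmem b u hu =>
          rw [M.slashMap_tmul F ℓ t w γ 1 (hmem 0 hv hu),
            hFO _ (Submodule.subset_span (Or.inl ⟨v, u, rfl⟩)), mul_zero, mul_zero]
    · change M.slashMap F ℓ t w γ (M.oqGen v u) τ = 0
      induction v using A.adjoint.sqWeight_induction with
      | hzero => simp [oqGen, sqMode_eq]
      | hadd v v' hv hv' => rw [oqGen_add_left, map_add, Pi.add_apply, hv, hv', add_zero]
      | hmem a v hv =>
        induction u using M.sqWeight_induction with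
        | hzero => simp [oqGen, sqMode_eq]
        | hadd u u' hu hu' => rw [oqGen_add_right, map_add, Pi.add_apply, hu, hu', add_zero]
        | hmem b u hu =>
          obtain ⟨N, hN⟩ := M.sqMode_truncation v u
          have h2 := hmem (-2) hv hu
          rw [oqGen, map_add, Pi.add_apply, M.slashMap_tmul F ℓ t w γ 1 h2,
            M.slashMap_eisen_sum hF ℓ t w γ _ _ (q := b + N₀ + a - (-2) - 1) (fun n => ?_)
              ⟨N.toNat, fun n hn => hN _ (by omega)⟩,
            OneMemClass.coe_one, Pi.one_apply, one_mul, ← mul_add, ← Pi.add_apply, ← map_add,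
            hFO _ (Submodule.subset_span (Or.inr ⟨v, u, rfl⟩)), mul_zero]
          have := hmem (2 * n + 2) hv hu
          convert! this using 4
          ring

/-- The space `C_1(U)` is stable under the twisted slash action. -/
theorem slashMap_mem_onePoint (M : VOAModule A U) {ℓ : ℍ → ℂ} (hℓ : MDiff ℓ)
    (hD : Derivative.normalizedDerivOfComplex ℓ = (12 : ℂ)⁻¹ • EisensteinSeries.E2)
    {t : ℂ} {w : ℤ} (hr : M.lowestWeight = t + w) (γ : SL(2, ℤ)) (F : M.onePoint) :
    M.slashMap F ℓ t w γ ∈ M.onePoint := by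
  obtain ⟨F, hF1, hF2, hF3, hF4⟩ := F
  refine ⟨M.slashMap_mdifferentiable hF1 hℓ t w γ, M.slashMap_smul F ℓ t w γ,
    fun x hx τ => M.slashMap_oq hF2 hF3 ℓ t w γ x hx τ, fun k u hu τ => ?_⟩
  by_cases h0 : u = 0
  · have hD0 := congrFun (Derivative.normalizedDerivOfComplex_const (0 : ℂ)) τ
    have hL : ∀ n, M.sqL n (0 : U) = 0 := fun n => by rw [sqL_eq, map_zero]
    subst h0
    simp only [hL, TensorProduct.tmul_zero, map_zero, Pi.zero_apply, finsum_zero, mul_zero,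
      add_zero]
    exact hD0.symm
  obtain ⟨n, rfl⟩ := M.exists_nat_of_mem_sqWeight hu h0
  have hu' : u ∈ M.sqWeight (M.lowestWeight + ((n : ℤ) : ℂ)) := by simpa using hu
  have hk : M.lowestWeight + (n : ℂ) = t + ((w + n : ℤ) : ℂ) := by rw [hr]; push_cast; ring
  have hfun : M.slashMap F ℓ t w γ (1 ⊗ₜ[ℂ] u) = fun τ => Complex.exp (t * (ℓ τ - ℓ (γ • τ))) *
      UpperHalfPlane.denom γ τ ^ (-(w + (n : ℤ))) * F (1 ⊗ₜ[ℂ] u) (γ • τ) := by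
    ext τ
    rw [M.slashMap_tmul F ℓ t w γ 1 hu', OneMemClass.coe_one, Pi.one_apply, one_mul]
  -- Condition (4) equates the Serre derivative of weight $k$ with $S(L[-2]u)-\sum
  -- E_{2l}S(L[2l-2]u)$. All these terms have total weight $k+2$, so they transform by the same
  -- factor as the derivative.
  have hserre := serreDerivative_twisted_slash hℓ hD t (w + n) (hF1 (1 ⊗ₜ[ℂ] u)) γ τ
  rw [← hfun] at hserre
  simp only [Derivative.serreDerivative_apply, ← hk] at hserre
  have h4 := hF4 _ u hu (γ • τ)
  rw [eisenTwo_eq] at h4 ⊢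
  have hL2 : M.sqL (-2) u ∈ M.sqWeight (M.lowestWeight + ((n + 2 : ℤ) : ℂ)) := by
    have := M.sqL_mem_sqWeight (-2) hu
    convert! this using 2
    push_cast; ring
  obtain ⟨N, hN⟩ := M.sqMode_truncation A.confTilde u
  have hsum := M.slashMap_eisen_sum hF2 ℓ t w γ (fun _ => 1) (fun j => M.sqL (2 * j + 2) u)
    (q := n + 2) (fun j => ?_) ⟨N.toNat, fun j hj => hN _ (by omega)⟩ τ
  · simp only [one_smul] at hsum
    rw [M.slashMap_tmul F ℓ t w γ 1 hL2, OneMemClass.coe_one, Pi.one_apply, one_mul, hsum, h4]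
    have e : -(w + (n + 2 : ℤ)) = -(w + n + 2 : ℤ) := by ring
    rw [e]
    linear_combination -hserre
  · have := M.sqL_mem_sqWeight (2 * j + 2) hu
    convert! this using 2
    push_cast; ring

theorem eval_add_right (M : VOAModule A U) (F : M.onePoint) (u v : U) (τ : ℍ) :
    M.eval F (u + v) τ = M.eval F u τ + M.eval F v τ := by
  simp [eval, TensorProduct.tmul_add]

theorem eval_zero_right (M : VOAModule A U) (F : M.onePoint) (τ : ℍ) : M.eval F 0 τ = 0 := by
  simp [eval]

/-- A one-point function is determined by its values on homogeneous elements of `U`. -/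
theorem onePoint_ext (M : VOAModule A U) {F G : M.onePoint}
    (h : ∀ (n : ℕ), ∀ u ∈ M.sqWeight (M.lowestWeight + n), ∀ τ, M.eval F u τ = M.eval G u τ) :
    F = G := by
  refine Subtype.ext (LinearMap.ext fun x => funext fun τ => ?_)
  induction x using TensorProduct.induction_on with
  | zero => simp
  | add x y hx hy => rw [map_add, map_add, Pi.add_apply, Pi.add_apply, hx, hy]
  | tmul f u =>
    have e : f ⊗ₜ[ℂ] u = f • ((1 : modularRing) ⊗ₜ[ℂ] u) := by
      rw [TensorProduct.smul_tmul', smul_eq_mul, mul_one]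
    rw [e, F.2.2.1, G.2.2.1]
    congr 1
    change M.eval F u τ = M.eval G u τ
    induction u using M.sqWeight_induction with
    | hzero => rw [eval_zero_right, eval_zero_right]
    | hadd u v hu hv =>
      rw [eval_add_right, eval_add_right,
        hu (by rw [TensorProduct.smul_tmul', smul_eq_mul, mul_one]),
        hv (by rw [TensorProduct.smul_tmul', smul_eq_mul, mul_one])]
    | hmem n u hu => exact h n u hu τ

/-- The right action of `SL(2,ℤ)` on `C_1(U)`. -/
theorem exists_slash (M : VOAModule A U) {ℓ : ℍ → ℂ} (hℓ : MDiff ℓ)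
    (hD : Derivative.normalizedDerivOfComplex ℓ = (12 : ℂ)⁻¹ • EisensteinSeries.E2)
    {t : ℂ} {w : ℤ} (hr : M.lowestWeight = t + w) :
    ∃ op : SL(2, ℤ) → M.onePoint →ₗ[ℂ] M.onePoint,
      op 1 = LinearMap.id ∧ (∀ γ δ, op (γ * δ) = op δ ∘ₗ op γ) ∧
      ∀ (γ : SL(2, ℤ)) (F : M.onePoint) (q : ℤ), ∀ u ∈ M.sqWeight (M.lowestWeight + q), ∀ τ : ℍ,
        M.eval (op γ F) u τ = Complex.exp (t * (ℓ τ - ℓ (γ • τ))) *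
          UpperHalfPlane.denom γ τ ^ (-(w + q)) * M.eval F u (γ • τ) := by
  let f : SL(2, ℤ) → M.onePoint → M.onePoint := fun γ F =>
    ⟨M.slashMap F ℓ t w γ, M.slashMap_mem_onePoint hℓ hD hr γ F⟩
  have hf : ∀ (γ : SL(2, ℤ)) (F : M.onePoint) (q : ℤ), ∀ u ∈ M.sqWeight (M.lowestWeight + q),
      ∀ τ : ℍ, M.eval (f γ F) u τ = Complex.exp (t * (ℓ τ - ℓ (γ • τ))) *
          UpperHalfPlane.denom γ τ ^ (-(w + q)) * M.eval F u (γ • τ) := by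
    intro γ F q u hu τ
    change M.slashMap F ℓ t w γ (1 ⊗ₜ[ℂ] u) τ = _
    rw [M.slashMap_tmul F ℓ t w γ 1 hu, OneMemClass.coe_one, Pi.one_apply, one_mul]
    rfl
  have hcast : ∀ {n : ℕ} {u : U}, u ∈ M.sqWeight (M.lowestWeight + n) →
      u ∈ M.sqWeight (M.lowestWeight + ((n : ℤ) : ℂ)) := fun h => by simpa using h
  refine ⟨fun γ =>
    { toFun := f γ
      map_add' := fun F G => M.onePoint_ext fun n u hu τ => ?_
      map_smul' := fun c F => M.onePoint_ext fun n u hu τ => ?_ }, ?_, fun γ δ => ?_, hf⟩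
  · have hadd : ∀ (F G : M.onePoint) (τ : ℍ), M.eval (F + G) u τ = M.eval F u τ + M.eval G u τ :=
      fun F G τ => rfl
    rw [hf _ _ _ u (hcast hu), hadd, hadd, hf _ _ _ u (hcast hu), hf _ _ _ u (hcast hu), mul_add]
  · have hsmul : ∀ (F : M.onePoint) (τ : ℍ), M.eval (c • F) u τ = c * M.eval F u τ :=
      fun F τ => rfl
    rw [RingHom.id_apply, hf _ _ _ u (hcast hu), hsmul, hsmul, hf _ _ _ u (hcast hu)]
    ring
  · refine LinearMap.ext fun F => M.onePoint_ext fun n u hu τ => ?_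
    change M.eval (f 1 F) u τ = M.eval F u τ
    rw [hf _ _ _ u (hcast hu)]
    simp [UpperHalfPlane.denom_one]
  · refine LinearMap.ext fun F => M.onePoint_ext fun n u hu τ => ?_
    change M.eval (f (γ * δ) F) u τ = M.eval (f δ (f γ F)) u τ
    rw [hf _ _ _ u (hcast hu), hf _ _ _ u (hcast hu), hf _ _ _ u (hcast hu), mul_smul, denom_mul,
      mul_zpow]
    have e : Complex.exp (t * (ℓ τ - ℓ (γ • δ • τ))) = Complex.exp (t * (ℓ τ - ℓ (δ • τ))) *
        Complex.exp (t * (ℓ (δ • τ) - ℓ (γ • δ • τ))) := by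
      rw [← Complex.exp_add]
      congr 1; ring
    rw [e]
    ring

end VOAModule

/-! ### From a right action to matrices and to a representation. -/

/-- A right action of a group on a space spanned by `N` vectors is given by matrices forming
a homomorphism, even if the vectors are linearly dependent. -/
theorem exists_GL_of_rightAction {G X : Type*} [Group G] [AddCommGroup X] [Module ℂ X]
    (op : G → X →ₗ[ℂ] X) (hone : op 1 = LinearMap.id) (hmul : ∀ g h, op (g * h) = op h ∘ₗ op g)
    {N : ℕ} (S : Fin N → X) (hS : Submodule.span ℂ (Set.range S) = ⊤) :
    ∃ R : G →* GL (Fin N) ℂ, ∀ g i,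
      op g (S i) = ∑ j, (R g : Matrix (Fin N) (Fin N) ℂ) i j • S j := by
  let π : (Fin N → ℂ) →ₗ[ℂ] X := Fintype.linearCombination ℂ S
  have hπ : LinearMap.range π = ⊤ := by
    rw [Fintype.range_linearCombination, hS]
  obtain ⟨s, hs⟩ := π.exists_rightInverse_of_surjective hπ
  have hs' : ∀ x, π (s x) = x := fun x => LinearMap.congr_fun hs x
  -- With `s` a section of `π`, coefficient vectors split as $\mathrm{range}\,s\oplus\ker\pi$. The
  -- lift `a g` is `op g` transported to the first summand and the identity on the second, so it
  -- stays multiplicative and invertible when the family is dependent.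
  let a : G → (Fin N → ℂ) →ₗ[ℂ] (Fin N → ℂ) := fun g =>
    s ∘ₗ op g ∘ₗ π + (LinearMap.id - s ∘ₗ π)
  have haπ : ∀ g v, π (a g v) = op g (π v) := fun g v => by simp [a, hs']
  have ha1 : a 1 = LinearMap.id := by
    ext1; simp [a, hone]
  have hamul : ∀ g h, a (g * h) = a h ∘ₗ a g := by
    intro g h
    refine LinearMap.ext fun v => ?_
    have e : a h (a g v) = s (op h (π (a g v))) + (a g v - s (π (a g v))) := rfl
    rw [LinearMap.comp_apply, e, haπ]
    simp [a, hmul]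
  -- Transposition reverses products and so turns the right action into a homomorphism; it also puts
  -- the coefficients of `op g (S i)` in row `i`.
  let R₀ : G →* Matrix (Fin N) (Fin N) ℂ :=
    { toFun := fun g => (LinearMap.toMatrix' (a g)).transpose
      map_one' := by rw [ha1, LinearMap.toMatrix'_id, Matrix.transpose_one]
      map_mul' := fun g h => by rw [hamul, LinearMap.toMatrix'_comp, Matrix.transpose_mul] }
  refine ⟨R₀.toHomUnits, fun g i => ?_⟩
  have h1 : π (Pi.single i 1) = S i := by
    simp [π, Fintype.linearCombination_apply_single]
  rw [← h1, ← haπ]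
  simp only [π, Fintype.linearCombination_apply]
  refine Finset.sum_congr rfl fun j _ => ?_
  congr 1

/-- The anti-automorphism of `SL(2,ℤ)` that exchanges the diagonal entries; it fixes `S`
and `T`. -/
def swapDiag (γ : SL(2, ℤ)) : SL(2, ℤ) :=
  ⟨!![γ 1 1, γ 0 1; γ 1 0, γ 0 0], by
    have := γ.det_coe
    rw [Matrix.det_fin_two] at this
    rw [Matrix.det_fin_two_of]
    linarith⟩

theorem swapDiag_mul (γ δ : SL(2, ℤ)) : swapDiag (γ * δ) = swapDiag δ * swapDiag γ := by
  ext i j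
  rw [Matrix.SpecialLinearGroup.coe_mul, Matrix.mul_apply, Fin.sum_univ_two]
  fin_cases i <;> fin_cases j <;> simp [swapDiag, Matrix.mul_apply, Fin.sum_univ_two] <;> ring

theorem swapDiag_one : swapDiag 1 = 1 := by
  ext i j
  fin_cases i <;> fin_cases j <;> simp [swapDiag]

theorem swapDiag_S : swapDiag ModularGroup.S = ModularGroup.S := by
  ext i j
  fin_cases i <;> fin_cases j <;> simp [swapDiag, ModularGroup.S]

theorem swapDiag_T : swapDiag ModularGroup.T = ModularGroup.T := by
  ext i j
  fin_cases i <;> fin_cases j <;> simp [swapDiag, ModularGroup.T]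

/-! ### Principal branches and the multiplier system. -/

section factors

variable {ℓ : ℍ → ℂ} {κ : SL(2, ℤ) → ℂ}

/-- On the upper half-plane $\arg\tau\in(0,\pi)$, so $\log(-i\tau)=\log\tau-\frac{\pi i}2$ for
principal branches, which is $\log\tau+\kappa(S)$. The other power of $\tau$ has the integral
exponent $-n$. -/
theorem factor_S (hκ : ∀ (γ : SL(2, ℤ)) (τ : ℍ),
      ℓ (γ • τ) = ℓ τ + Complex.log (UpperHalfPlane.denom γ τ) + κ γ)
    (hS : κ ModularGroup.S = -(Real.pi / 2 * Complex.I)) (t : ℂ) (n : ℤ) (τ : ℍ) :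
    (-Complex.I * (τ : ℂ)) ^ (-t) * (τ : ℂ) ^ (t - (t + n)) =
      Complex.exp (t * (ℓ τ - ℓ (ModularGroup.S • τ))) *
        UpperHalfPlane.denom ModularGroup.S τ ^ (-n) := by
  have hτ := τ.ne_zero
  have hlog : Complex.log (-Complex.I * (τ : ℂ)) = Complex.log τ - Real.pi / 2 * Complex.I := by
    have h1 : -Complex.I * (τ : ℂ) = Complex.exp (Complex.log τ - Real.pi / 2 * Complex.I) := by
      rw [Complex.exp_sub, Complex.exp_log hτ, Complex.exp_pi_div_two_mul_I, div_eq_mul_inv,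
        Complex.inv_I, mul_comm]
    have him : 0 ≤ (Complex.log (τ : ℂ)).im := by
      rw [Complex.log_im]
      exact Complex.arg_nonneg_iff.mpr τ.im_pos.le
    have him' := Complex.log_im_le_pi (τ : ℂ)
    have e : (Complex.log (τ : ℂ) - Real.pi / 2 * Complex.I).im =
        (Complex.log (τ : ℂ)).im - Real.pi / 2 := by simp
    rw [h1, Complex.log_exp]
    · rw [e]; linarith [Real.pi_pos]
    · rw [e]; linarith [Real.pi_pos]
  rw [hκ, ModularGroup.denom_S, hS, Complex.cpow_def_of_ne_zero
    (mul_ne_zero (neg_ne_zero.mpr Complex.I_ne_zero) hτ), hlog,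
    show t - (t + (n : ℂ)) = ((-n : ℤ) : ℂ) by push_cast; ring, Complex.cpow_intCast]
  congr 2
  ring

theorem factor_T (hκ : ∀ (γ : SL(2, ℤ)) (τ : ℍ),
      ℓ (γ • τ) = ℓ τ + Complex.log (UpperHalfPlane.denom γ τ) + κ γ)
    (hT : κ ModularGroup.T = Real.pi / 6 * Complex.I) (t : ℂ) (n : ℤ) (τ : ℍ) :
    Complex.I ^ (-t / 3) = Complex.exp (t * (ℓ τ - ℓ (ModularGroup.T • τ))) *
        UpperHalfPlane.denom ModularGroup.T τ ^ (-n) := by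
  have hdT : UpperHalfPlane.denom ModularGroup.T (τ : ℂ) = 1 := by
    rw [ModularGroup.denom_apply]; simp [ModularGroup.T]
  rw [hκ, hdT, hT, Complex.log_one, one_zpow, mul_one,
    Complex.cpow_def_of_ne_zero Complex.I_ne_zero, Complex.log_I]
  congr 1
  ring

/-- The automorphy factor of weight `t` is `e^{t(ℓ(γτ) - ℓ(τ))}`. -/
theorem automorphy_factor_eq (hκ : ∀ (γ : SL(2, ℤ)) (τ : ℍ),
      ℓ (γ • τ) = ℓ τ + Complex.log (UpperHalfPlane.denom γ τ) + κ γ)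
    (t : ℂ) (γ : SL(2, ℤ)) (τ : ℍ) :
    Complex.exp (t * κ γ) * (((γ 1 0 : ℤ) : ℂ) * (τ : ℂ) + ((γ 1 1 : ℤ) : ℂ)) ^ t =
      Complex.exp (t * (ℓ (γ • τ) - ℓ τ)) := by
  rw [← ModularGroup.denom_apply, Complex.cpow_def_of_ne_zero (UpperHalfPlane.denom_ne_zero _ _),
    hκ, ← Complex.exp_add]
  congr 1
  ring

/-- Written as $e^{t(\ell(\gamma\tau)-\ell(\tau))}$ the factor telescopes; `ν` has modulus 1 because
`κ` is purely imaginary and `t` is real. -/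
theorem isMultiplierSystem_exp (hκ : ∀ (γ : SL(2, ℤ)) (τ : ℍ),
      ℓ (γ • τ) = ℓ τ + Complex.log (UpperHalfPlane.denom γ τ) + κ γ)
    (hre : ∀ γ, (κ γ).re = 0) (t : ℝ) :
    IsMultiplierSystem t fun γ => Complex.exp (t * κ γ) := by
  constructor
  · intro γ
    simp [Complex.norm_exp, hre]
  · intro γ δ τ
    rw [automorphy_factor_eq hκ, automorphy_factor_eq hκ, automorphy_factor_eq hκ,
      ← Complex.exp_add, mul_smul]
    congr 1
    ring

end factors

namespace VOAModule

variable {V : Type*} [AddCommGroup V] [Module ℂ V] {A : VertexOperatorAlgebra V}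
  {U : Type*} [AddCommGroup U] [Module ℂ U]

/-- Reduces an arbitrary complex weight `k` to $k\in t+\mathbb Z$, the only case with nonzero
vectors. -/
theorem eval_eq_zero_or_exists_int (M : VOAModule A U) {t : ℂ} {w : ℤ}
    (hr : M.lowestWeight = t + w) {k : ℂ} {u : U} (hu : u ∈ M.sqWeight k) :
    u = 0 ∨ ∃ q : ℤ, u ∈ M.sqWeight (M.lowestWeight + q) ∧ k = t + ((w + q : ℤ) : ℂ) := by
  by_cases h0 : u = 0
  · exact Or.inl h0
  · obtain ⟨n, rfl⟩ := M.exists_nat_of_mem_sqWeight hu h0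
    refine Or.inr ⟨n, by simpa using hu, ?_⟩
    rw [hr]
    push_cast
    ring

/-- A representation satisfying `IsModularAction` is unique. -/
theorem IsModularAction.unique {M : VOAModule A U} {t : ℝ}
    {ρ σ : Representation ℂ SL(2, ℤ) M.onePoint} (hρ : M.IsModularAction t ρ)
    (hσ : M.IsModularAction t σ) : ρ = σ := by
  have hcl : Subgroup.closure {ModularGroup.S, ModularGroup.T} = (⊤ : Subgroup SL(2, ℤ)) :=
    SpecialLinearGroup.SL2Z_generators
  refine MonoidHom.eq_of_eqOn_dense hcl ?_
  rintro γ (rfl | rfl)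
  · refine LinearMap.ext fun F => M.onePoint_ext fun n u hu τ => ?_
    rw [hρ.1 F _ u hu, hσ.1 F _ u hu]
  · refine LinearMap.ext fun F => M.onePoint_ext fun n u hu τ => ?_
    rw [hρ.2 F u, hσ.2 F u]

/-- The matrix is $S^{-1}=S^3$. On weights $t+2n$, applying $S$ twice multiplies values by
$\tau^{-2n}(-1/\tau)^{-2n}=1$, the exponentials being inverse to each other, so $S^3$ acts as $S$.
The evenness of $k-t$ removes the sign. -/
theorem IsModularAction.S_inv_apply {M : VOAModule A U} {t : ℝ} {ℓ : ℍ → ℂ}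
    {κ : SL(2, ℤ) → ℂ} (hκ : ∀ (γ : SL(2, ℤ)) (τ : ℍ),
      ℓ (γ • τ) = ℓ τ + Complex.log (UpperHalfPlane.denom γ τ) + κ γ)
    (hS : κ ModularGroup.S = -(Real.pi / 2 * Complex.I))
    {ρ : Representation ℂ SL(2, ℤ) M.onePoint} (hρ : M.IsModularAction t ρ) (F : M.onePoint)
    (n : ℤ) {u : U} (hu : u ∈ M.sqWeight ((t : ℂ) + 2 * n)) (τ : ℍ) :
    M.eval (ρ ⟨!![0, 1; -1, 0], by simp [Matrix.det_fin_two]⟩ F) u τ =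
      (-Complex.I * (τ : ℂ)) ^ (-(t : ℂ)) * (τ : ℂ) ^ ((t : ℂ) - ((t : ℂ) + 2 * n)) *
        M.eval F u (ModularGroup.S • τ) := by
  have hSSS : (⟨!![0, 1; -1, 0], by simp [Matrix.det_fin_two]⟩ : SL(2, ℤ)) =
      ModularGroup.S * (ModularGroup.S * ModularGroup.S) := by
    ext i j
    rw [Matrix.SpecialLinearGroup.coe_mul, Matrix.SpecialLinearGroup.coe_mul]
    fin_cases i <;> fin_cases j <;> simp [ModularGroup.S]
  have hSS : ModularGroup.S • (ModularGroup.S • τ) = τ := by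
    ext
    rw [UpperHalfPlane.modular_S_smul, UpperHalfPlane.modular_S_smul]
    simp
  rw [hSSS, map_mul, map_mul, Module.End.mul_apply, Module.End.mul_apply, hρ.1 _ _ u hu,
    hρ.1 _ _ u hu, hρ.1 _ _ u hu, hSS, ← mul_assoc, ← mul_assoc]
  congr 1
  have hcast : (t : ℂ) + 2 * n = t + ((2 * n : ℤ) : ℂ) := by push_cast; rfl
  rw [hcast, factor_S hκ hS, factor_S hκ hS, hSS]
  have hcoe : ((ModularGroup.S • τ : ℍ) : ℂ) = -(τ : ℂ)⁻¹ := by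
    rw [UpperHalfPlane.modular_S_smul]
    simp
  have hτ := τ.ne_zero
  rw [ModularGroup.denom_S, ModularGroup.denom_S, hcoe]
  have e1 : (-(τ : ℂ)⁻¹) ^ (-(2 * n)) = ((τ : ℂ) ^ (-(2 * n)))⁻¹ := by
    rw [Even.neg_zpow (by simp), inv_zpow]
  have e2 : Complex.exp (t * (ℓ τ - ℓ (ModularGroup.S • τ))) *
      Complex.exp (t * (ℓ (ModularGroup.S • τ) - ℓ τ)) = 1 := by
    rw [← Complex.exp_add, ← Complex.exp_zero]
    congr 1; ring
  have e3 : (τ : ℂ) ^ (-(2 * n)) ≠ 0 := zpow_ne_zero _ hτ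
  rw [e1]
  set z := (τ : ℂ) ^ (-(2 * n))
  have e4 : z * z⁻¹ = 1 := mul_inv_cancel₀ e3
  set E := Complex.exp (t * (ℓ τ - ℓ (ModularGroup.S • τ)))
  linear_combination (E * z * (z * z⁻¹)) * e2 + E * z * e4

end VOAModule

end

/-! ### The main theorem. -/

theorem lemma5p2 {V : Type*} [AddCommGroup V] [Module ℂ V] (A : VertexOperatorAlgebra V)
    {U : Type*} [AddCommGroup U] [Module ℂ U] (M : VOAModule A U)
    (t : ℝ) (m : ℤ) (ht : M.lowestWeight = (t : ℂ) + 2 * m) :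
    (∃! ρ : Representation ℂ SL(2, ℤ) M.onePoint, M.IsModularAction t ρ) ∧
    (∀ ρ : Representation ℂ SL(2, ℤ) M.onePoint, M.IsModularAction t ρ →
      ∀ (S : M.onePoint) (n : ℤ), ∀ u ∈ M.sqWeight ((t : ℂ) + 2 * n), ∀ τ : ℍ,
        M.eval (ρ ⟨!![0, 1; -1, 0], by simp [Matrix.det_fin_two]⟩ S) u τ =
          (-Complex.I * (τ : ℂ)) ^ (-(t : ℂ)) * (τ : ℂ) ^ ((t : ℂ) - ((t : ℂ) + 2 * n)) *
            M.eval S u (ModularGroup.S • τ)) ∧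
    (∃ ν : SL(2, ℤ) → ℂ, IsMultiplierSystem t ν ∧
      ν ModularGroup.S = Complex.I ^ (-(t : ℂ)) ∧
      ν ModularGroup.T = Complex.I ^ ((t : ℂ) / 3) ∧
      ∀ (N : ℕ) (S : Fin N → M.onePoint), Submodule.span ℂ (Set.range S) = ⊤ →
        ∃ R : SL(2, ℤ) →* GL (Fin N) ℂ,
          ∀ (k : ℂ), ∀ u ∈ M.sqWeight k, ∀ (γ : SL(2, ℤ)) (τ : ℍ) (i : Fin N),
            M.eval (S i) u (γ • τ) =
              ν γ * (((γ 1 0 : ℤ) : ℂ) * (τ : ℂ) + ((γ 1 1 : ℤ) : ℂ)) ^ k *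
                ∑ j, (R γ : Matrix (Fin N) (Fin N) ℂ) i j * M.eval (S j) u τ) := by
  obtain ⟨ℓ, κ, hℓ, hD, hκ, hre, hS, hT⟩ := exists_logEta
  have hr : M.lowestWeight = (t : ℂ) + ((2 * m : ℤ) : ℂ) := by rw [ht]; push_cast; rfl
  obtain ⟨op, hop1, hopmul, hop⟩ := M.exists_slash hℓ hD hr
  refine ⟨?_, fun ρ hρ F n u hu τ => hρ.S_inv_apply hκ hS F n hu τ, ?_⟩
  -- Composition with the inverse would also give a representation, but with $S^{-1}$ and $T^{-1}$
  -- acting by the required formulas; `swapDiag` reverses products and fixes $S$ and $T$.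
  · let ρ : Representation ℂ SL(2, ℤ) M.onePoint :=
      { toFun := fun γ => op (swapDiag γ)
        map_one' := by rw [swapDiag_one, hop1]; rfl
        map_mul' := fun γ δ => by rw [swapDiag_mul, hopmul]; rfl }
    have hρS : ρ ModularGroup.S = op ModularGroup.S := by
      change op (swapDiag _) = _
      rw [swapDiag_S]
    have hρT : ρ ModularGroup.T = op ModularGroup.T := by
      change op (swapDiag _) = _
      rw [swapDiag_T]
    have hρ : M.IsModularAction t ρ := by
      constructor
      · intro F k u hu τ
        rw [hρS]
        rcases M.eval_eq_zero_or_exists_int hr hu with rfl | ⟨q, hq, rfl⟩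
        · rw [M.eval_zero_right, M.eval_zero_right, mul_zero]
        · rw [hop _ F q u hq, factor_S hκ hS]
      · intro F u τ
        rw [hρT]
        induction u using M.sqWeight_induction with
        | hzero => rw [M.eval_zero_right, M.eval_zero_right, mul_zero]
        | hadd u v hu hv => rw [M.eval_add_right, M.eval_add_right, hu, hv, mul_add]
        | hmem n u hu =>
          rw [hop _ F n u (by simpa using hu), ← factor_T hκ hT]
    exact ⟨ρ, hρ, fun σ hσ => hσ.unique hρ⟩
  · refine ⟨fun γ => Complex.exp (t * κ γ), isMultiplierSystem_exp hκ hre t, ?_, ?_, ?_⟩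
    · beta_reduce
      rw [Complex.cpow_def_of_ne_zero Complex.I_ne_zero, Complex.log_I, hS]
      congr 1; ring
    · beta_reduce
      rw [Complex.cpow_def_of_ne_zero Complex.I_ne_zero, Complex.log_I, hT]
      congr 1; ring
    · intro N S hspan
      obtain ⟨R, hR⟩ := exists_GL_of_rightAction op hop1 hopmul S hspan
      refine ⟨R, fun k u hu γ τ i => ?_⟩
      rcases M.eval_eq_zero_or_exists_int hr hu with rfl | ⟨q, hq, rfl⟩
      · simp [M.eval_zero_right]
      have hsum : ∑ j, (R γ : Matrix (Fin N) (Fin N) ℂ) i j * M.eval (S j) u τ =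
          M.eval (op γ (S i)) u τ := by
        rw [hR γ i]
        simp [VOAModule.eval, LinearMap.sum_apply]
      have hden := UpperHalfPlane.denom_ne_zero (γ : GL (Fin 2) ℝ) τ
      -- Since $k-t$ is an integer, $(c\tau+d)^k$ splits into the principal power of exponent $t$
      -- and an integral power; the total is the inverse of the factor in `hop`.
      have hfac : Complex.exp (t * κ γ) *
          (((γ 1 0 : ℤ) : ℂ) * (τ : ℂ) + ((γ 1 1 : ℤ) : ℂ)) ^ ((t : ℂ) + ((2 * m + q : ℤ) : ℂ)) =
          Complex.exp (t * (ℓ (γ • τ) - ℓ τ)) * UpperHalfPlane.denom γ τ ^ (2 * m + q) := by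
        rw [← automorphy_factor_eq hκ, ← ModularGroup.denom_apply, Complex.cpow_add _ _ hden,
          Complex.cpow_intCast]
        ring
      have e2 : Complex.exp (t * (ℓ (γ • τ) - ℓ τ)) *
          Complex.exp (t * (ℓ τ - ℓ (γ • τ))) = 1 := by
        rw [← Complex.exp_add, ← Complex.exp_zero]
        congr 1; ring
      rw [hsum, hop γ (S i) q u hq, hfac, zpow_neg]
      have hz := zpow_ne_zero (2 * m + q) hden
      field_simp
      linear_combination (-M.eval (S i) u (γ • τ)) * e2
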